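/- Let $f:\mathbb R^n\to\mathbb R$ ($n\ge1$) be convex and differentiable with $L$-Lipschitz gradient, let $x_*$ be a minimiser of $f$, and let $\|x_*\|\le R$. *Oracle.* Let $\xi$ be a random element of $\Xi$ and let $g(x,\xi)\in\mathbb R^n$ be (jointly) measurable with, for all $x$, $\mathbb E_\xi[g(x,\xi)]=\nabla f(x)$, $\mathbb E_\xi[\exp(\|g(x,\xi)-\nabla f(x)\|^2/\sigma^2)]\le e$ with $\sigma>0$, and $\|g(x,\xi)\|_1\le B$ for all $\xi\in\Xi$. Given a batch size $r\ge1$ and a number $M\ge1$ of quantization samples, the PPS (probability-proportional-to-size) quantized gradient oracle at $x$ draws independent copies $\xi_1,\dots,\xi_r$ of $\xi$, puts $\boldsymbol G=\frac1r\sum_{i=1}^r g(x,\xi_i)$, draws, independently given $\boldsymbol G$, indices $k_1,\dots,k_M$ with probabilities $[\boldsymbol G_k]_+/\|[\boldsymbol G]_+\|_1$ and $l_1,\dots,l_M$ with probabilities $[-\boldsymbol G_l]_+/\|[-\boldsymbol G]_+\|_1$, and returns $$\frac{\|[\boldsymbol G]_+\|_1}{M}\sum_{i=1}^M e_{k_i}-\frac{\|[-\boldsymbol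 G]_+\|_1}{M}\sum_{i=1}^M e_{l_i},$$ where $[v]_+$ is the componentwise positive part and $e_i$ is the $i$th standard basis vector (a term with $\|[\pm\boldsymbol G]_+\|_1=0$ is zero). Let $\sigma_{r,M}^2=50\left(\frac{2(1-1/n)B^2}{eM}+\frac{\sigma^2}{r}\right)$. *Method.* Let $T\ge 0$ be an integer, $r_t,M_t\ge1$ integers for $0\le t\le T$, and let $\alpha_t\ge0$, $\beta_t$ and $A_t=\sum_{i=0}^t\alpha_i$ satisfy $0<\alpha_0\le1$, $L<\beta_t$ for $0\le t\le T$, and $\beta_t\le\beta_{t+1}$, $\alpha_{t+1}^2\beta_{t+1}\le\beta_tA_{t+1}$ for $0\le t<T$. Let $G_t$ be the answer of the PPS quantized oracle at $y_t$ with parameters $r_t,M_t$, with fresh independent randomness for every $t$, where $y_0=0$, $x_0=-\frac{\alpha_0}{\beta_0}G_0$, and for $t=0,\dots,T-1$ $$z_t=-\frac1{\beta_t}\sum_{i=0}^t\alpha_iG_i,\quad \tau_t=\frac{\alpha_{t+1}}{A_{t+1}},\quad y_{t+1}=\tau_tz_t+(1-\tau_t)x_t,\quad \hat y_{t+1}=z_t-\frac{\alpha_{t+1}}{\beta_t}G_{t+1},\quad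 x_{t+1}=\tau_t\hat y_{t+1}+(1-\tau_t)x_t .$$ **Theorem.** There is a function $J$ of $T$ alone, with $J(T)=O(\mathrm{poly}(\log T))$ as $T\to\infty$, such that for all data as above and all $\delta\in(0,1)$ $$P\bigl(f(x_T)-f(x_*)\le\varepsilon\bigr)>1-\delta,\qquad \varepsilon=\frac{\beta_TR^2}{2A_T}+\frac{C_1'R}{A_T}\sqrt{\sum_{t=0}^T\alpha_t^2\sigma_{r_t,M_t}^2}+\frac{C_2'}{A_T}\sum_{t=0}^T\frac{A_t\sigma_{r_t,M_t}^2}{\beta_t-L},$$ where $$C_2'=1+\ln\frac4\delta=O(\log(1/\delta))\quad(\delta\to0),$$ $$C_1'=\bigl(2J(T)+\sqrt2-1\bigr)\Bigl(\sqrt2+(\sqrt2+1)\sqrt{3\ln\tfrac4\delta}\Bigr)+\sqrt2-2=O\bigl(\mathrm{poly}(\log T)\sqrt{\log(1/\delta)}\bigr)\quad(T\to\infty,\ \delta\to0).$$ Here $\mathrm{poly}(s)=1+s+\dots+s^i$ for some fixed $i\in\mathbb N$. -/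

import Mathlib

open MeasureTheory ProbabilityTheory Filter Asymptotics
open scoped Topology NNReal

namespace PPS

noncomputable section

/-- `ℝⁿ` with the Euclidean norm. -/
abbrev Vec (n : ℕ) : Type := EuclideanSpace ℝ (Fin n)

/-- The Manhattan norm `‖v‖₁` of a vector. -/
def norm1 {n : ℕ} (v : Vec n) : ℝ := ∑ i, |v i|

/-! ### The stochastic gradient oracle -/

/-- `g(x, ξ)`, `ξ ∼ P`, is an unbiased stochastic gradient oracle for `f` whose noise is
`σ`-sub-Gaussian and whose values are bounded by `B` in the Manhattan norm. (The integrands below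
are bounded and measurable in `ξ`, so that both Bochner integrals are genuine expectations.) -/
structure IsGradientOracle {n : ℕ} {Ξ : Type*} [MeasurableSpace Ξ] (P : Measure Ξ)
    (f : Vec n → ℝ) (g : Vec n → Ξ → Vec n) (σ B : ℝ) : Prop where
  measurable : Measurable (Function.uncurry g)
  unbiased : ∀ x, ∫ ξ, g x ξ ∂P = gradient f x
  subGaussian : ∀ x, ∫ ξ, Real.exp (‖g x ξ - gradient f x‖ ^ 2 / σ ^ 2) ∂P ≤ Real.exp 1
  bounded : ∀ x ξ, norm1 (g x ξ) ≤ B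

/-- The mini-batch oracle `G(x, ξ) = (1/r) ∑ᵢ g(x, ξᵢ)`. -/
def minibatch {n : ℕ} {Ξ : Type*} (g : Vec n → Ξ → Vec n) {r : ℕ} (x : Vec n)
    (ξ : Fin r → Ξ) : Vec n :=
  (1 / (r : ℝ)) • ∑ i, g x (ξ i)

/-! ### Probability-proportional-to-size quantization -/

/-- `[v]₊`, the componentwise positive part. -/
def plusPart {n : ℕ} (v : Vec n) : Vec n := WithLp.toLp 2 fun i => max 0 (v i)

/-- `P_v(k) = [v_k]₊ / ‖[v]₊‖₁`. -/
def catProb {n : ℕ} (v : Vec n) (k : Fin n) : ℝ := plusPart v k / norm1 (plusPart v)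

/-- A sample from the categorical distribution `P_v`, obtained from a uniform `u ∈ [0, 1]`: the
least index `k` with `u ≤ P_v(0) + ⋯ + P_v(k)`. (If `[v]₊ = 0`, there is no distribution `P_v`; the
value returned then is irrelevant, because it gets the weight `‖[v]₊‖₁ = 0` in `pps`.) -/
def catSample {n : ℕ} [NeZero n] (v : Vec n) (u : unitInterval) : Fin n :=
  if h : (Finset.univ.filter fun k : Fin n => (u : ℝ) ≤ ∑ j ∈ Finset.Iic k, catProb v j).Nonempty
  then Finset.min' _ h else 0

/-- The PPS quantization of `G` with `M` samples `k₁, …, k_M` from `P_G` and `M` samples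
`l₁, …, l_M` from `P_{-G}`, generated from the numbers `uᵢ` and `wᵢ` in `[0, 1]`:
`(‖[G]₊‖₁ / M) ∑ᵢ e_{kᵢ} - (‖[-G]₊‖₁ / M) ∑ᵢ e_{lᵢ}`. -/
def pps {n : ℕ} [NeZero n] {M : ℕ} (G : Vec n) (u w : Fin M → unitInterval) : Vec n :=
  (norm1 (plusPart G) / (M : ℝ)) • ∑ i, EuclideanSpace.single (catSample G (u i)) (1 : ℝ)
    - (norm1 (plusPart (-G)) / (M : ℝ)) • ∑ i, EuclideanSpace.single (catSample (-G) (w i)) (1 : ℝ)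

/-- The randomness `(ξ, u, w)` consumed by one call of the PPS quantized gradient oracle with batch
size `r` and `M` quantization samples. -/
abbrev Draw (Ξ : Type*) (r M : ℕ) : Type _ := (Fin r → Ξ) × (Fin M → unitInterval) × (Fin M → unitInterval)

/-- The law of the randomness of one call: all components are independent, the `ξᵢ` have the law
`P`, the `uᵢ` and `wᵢ` are uniform on `[0, 1]`. -/
def drawLaw {Ξ : Type*} [MeasurableSpace Ξ] (P : Measure Ξ) (r M : ℕ) : Measure (Draw Ξ r M) :=
  (Measure.pi fun _ : Fin r => P).prod
    ((Measure.pi fun _ : Fin M => (volume : Measure unitInterval)).prod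
      (Measure.pi fun _ : Fin M => (volume : Measure unitInterval)))

/-- The PPS quantized gradient oracle at the point `x` with the randomness `d`. -/
def ppsOracle {n : ℕ} [NeZero n] {Ξ : Type*} (g : Vec n → Ξ → Vec n) {r M : ℕ}
    (d : Draw Ξ r M) (x : Vec n) : Vec n :=
  pps (minibatch g x d.1) d.2.1 d.2.2

/-- `σ²_{r,M} = 50 (2 (1 - 1/n) B² / (e M) + σ² / r)`. -/
def noiseVar (n : ℕ) (σ B : ℝ) (r M : ℕ) : ℝ :=
  50 * (2 * (1 - 1 / (n : ℝ)) * B ^ 2 / (Real.exp 1 * M) + σ ^ 2 / r)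

/-! ### The primal method -/

/-- `A_t = ∑_{i = 0}^t α_i`. -/
def cumWeight (α : ℕ → ℝ) (t : ℕ) : ℝ := ∑ i ∈ Finset.range (t + 1), α i

/-- The conditions on the coefficients of a run with `T` iterations. -/
structure AdmissibleCoeffs (L : ℝ) (T : ℕ) (α β : ℕ → ℝ) : Prop where
  nonneg : ∀ t ≤ T, 0 ≤ α t
  zero_pos : 0 < α 0
  zero_le_one : α 0 ≤ 1
  lt_beta : ∀ t ≤ T, L < β t
  beta_mono : ∀ t < T, β t ≤ β (t + 1)
  step : ∀ t < T, α (t + 1) ^ 2 * β (t + 1) ≤ β t * cumWeight α (t + 1)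

/-- The primal method: `primalState α β query t` is the pair `(∑_{i ≤ t} α_i G_i, x_t)`, where
`query t y` is the answer of the gradient oracle to the call number `t`, made at `y`. -/
def primalState {n : ℕ} (α β : ℕ → ℝ) (query : ℕ → Vec n → Vec n) : ℕ → Vec n × Vec n
  | 0 =>
    let G := query 0 0
    (α 0 • G, -(α 0 / β 0) • G)
  | t + 1 =>
    let s := (primalState α β query t).1
    let x := (primalState α β query t).2
    let z := -(1 / β t) • s
    let τ := α (t + 1) / cumWeight α (t + 1)
    let y := τ • z + (1 - τ) • x
    let G := query (t + 1) y
    let y' := z - (α (t + 1) / β t) • G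
    (s + α (t + 1) • G, τ • y' + (1 - τ) • x)

/-- The output `x_T` of the primal method with the PPS quantized gradient oracle, the call number
`t` of which uses the batch size `r t`, `M t` quantization samples and the randomness `d t`. -/
def primalOutput {n : ℕ} [NeZero n] {Ξ : Type*} (g : Vec n → Ξ → Vec n) (α β : ℕ → ℝ)
    (r M : ℕ → ℕ) (d : (t : ℕ) → Draw Ξ (r t) (M t)) (T : ℕ) : Vec n :=
  (primalState α β (fun t => ppsOracle g (d t)) T).2

/-! ### The bound -/

/-- `poly(y) = 1 + y + ⋯ + yⁱ`. -/
def poly (i : ℕ) (y : ℝ) : ℝ := ∑ j ∈ Finset.range (i + 1), y ^ j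

/-- `C'₂ = 1 + ln (4/δ)`. -/
def C₂ (δ : ℝ) : ℝ := 1 + Real.log (4 / δ)

/-- `C'₁ = (2 J(T) + √2 - 1) (√2 + (√2 + 1) √(3 ln (4/δ))) + √2 - 2`. -/
def C₁ (J : ℕ → ℝ) (T : ℕ) (δ : ℝ) : ℝ :=
  (2 * J T + √2 - 1) * (√2 + (√2 + 1) * √(3 * Real.log (4 / δ))) + √2 - 2

/-- The accuracy `ε`, with `v t` in the place of `σ²_{r_t,M_t}`. -/
def accuracy (J : ℕ → ℝ) (T : ℕ) (δ L R : ℝ) (α β v : ℕ → ℝ) : ℝ :=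
  β T * R ^ 2 / (2 * cumWeight α T)
    + C₁ J T δ * R / cumWeight α T * √(∑ t ∈ Finset.range (T + 1), α t ^ 2 * v t)
    + C₂ δ / cumWeight α T * ∑ t ∈ Finset.range (T + 1), cumWeight α t * v t / (β t - L)

end

end PPS

/-!
The bound holds with the constant `J = 1`: no logarithmic growth in `T` is needed.

*Oracle noise.* The error of one oracle call is a sum of independent centred increments: `r` from
the mini-batch and `2 M` from quantization. Pinelis' inequality (`cosh_norm_add_le`) shows that an
increment of variance proxy `s²` multiplies the mean of `cosh (lam ‖x‖)` by at most
`exp (lam² s²)`, in every dimension; the same holds for `exp ⟪u, x⟫` with `lam = ‖u‖`. Both are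
instances of `IsExpTest`. Summing up (`lintegral_ppsOracle_le`), the error has variance proxy
`v / 9` with `v = noiseVar`. Averaging `cosh (s ‖η‖)` over a Gaussian `s` turns this into
`𝔼 exp (2 ‖η‖² / v) ≤ 3`, and the linear and quadratic parts combine to
`𝔼 exp (⟪u, η⟫ + θ ‖η‖² / v) ≤ exp ((2/9) v ‖u‖² + θ)` for `0 ≤ θ ≤ 1`
(`lintegral_exp_oracleError_le`).

*Estimate sequence.* Deterministically (`gap_le_errorSum`), with `u_t = x_* - z_{t-1}`,
`A_t (f x_t - f x_*) + (β_t / 2) ‖u_{t+1}‖² ≤ (β_t / 2) ‖x_*‖² + S`, where `S` is the sum over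
`s ≤ t` of `α_s ⟪η_s, u_s⟫ + A_s ‖η_s‖² / (2 (β_s - L))`. It serves twice: for `t = T` it bounds the
gap, and for `t < T` it bounds `‖u_{t+1}‖`, on which the conditional variance of the next martingale
increment depends, by the accumulated error `S` itself.

*Exponential moment.* This feedback adds to the exponent `lam` of `𝔼 exp (lam S)` a multiple of
`lam²` in each step back in time. The condition `lam (m + (4/9) q) ≤ 1`, with `q` the sum of the
weights `w_s = A_s v_s / (β_s - L)` up to the current step, is stable under this recursion, since
`α_s² / β_{s-1} ≤ A_s / β_s`. The result is
`𝔼 exp (lam S) ≤ exp ((2/9) R² D² / m² + q / (2 m))` with `D² = ∑ α_s² v_s`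
(`lintegral_exp_errorSum_le`). Markov's inequality with a suitable `m` (`exponent_le`) finishes the
proof, and even gives the probability `1 - δ / 4`.
-/

namespace PPS

open scoped RealInnerProductSpace ENNReal

/-! ### Exponential test functions -/

section ExpTest

theorem exp_le_self_add_exp_sq (x : ℝ) : Real.exp x ≤ x + Real.exp (x ^ 2) := by
  have h2 : x ^ 2 + 1 ≤ Real.exp (x ^ 2) := Real.add_one_le_exp _
  rcases le_or_gt |x| 1 with h | h
  · have := (abs_le.1 (Real.abs_exp_sub_one_sub_id_le h)).2
    linarith
  · rcases lt_abs.1 h with h | h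
    · have : Real.exp x ≤ Real.exp (x ^ 2) := Real.exp_le_exp.2 (by nlinarith)
      linarith
    · have : Real.exp x ≤ 1 := Real.exp_le_one_iff.2 (by linarith)
      nlinarith

/-- Chord inequality for the convex function `s ↦ cosh √s`; the convexity is that of each monomial
of its power series. -/
theorem cosh_sqrt_convex {p u v : ℝ} (hp : 0 ≤ p) (hp1 : p ≤ 1) :
    Real.cosh √((1 - p) * u ^ 2 + p * v ^ 2) ≤ (1 - p) * Real.cosh u + p * Real.cosh v := by
  have hS : 0 ≤ (1 - p) * u ^ 2 + p * v ^ 2 := by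
    have : 0 ≤ 1 - p := by linarith
    positivity
  refine hasSum_le (fun k => ?_) (Real.hasSum_cosh _)
    (((Real.hasSum_cosh u).mul_left (1 - p)).add ((Real.hasSum_cosh v).mul_left p))
  have h := (convexOn_pow (𝕜 := ℝ) k).2 (Set.mem_Ici.2 (sq_nonneg u)) (Set.mem_Ici.2 (sq_nonneg v))
    (sub_nonneg.2 hp1) hp (by ring)
  simp only [smul_eq_mul] at h
  rw [pow_mul, Real.sq_sqrt hS, pow_mul, pow_mul, mul_div_assoc', mul_div_assoc', ← add_div]
  gcongr

variable {E : Type*} [NormedAddCommGroup E] [InnerProductSpace ℝ E]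

/-- Pinelis' inequality: `cosh ‖·‖` grows under an increment `h` by at most the factor
`exp ‖h‖ - ‖h‖`, up to a term that is linear in `h`. -/
theorem cosh_norm_add_le (x h : E) :
    Real.cosh ‖x + h‖ ≤ Real.cosh ‖x‖ * (Real.exp ‖h‖ - ‖h‖)
      + Real.sinh ‖x‖ / ‖x‖ * ⟪x, h⟫ := by
  have hsb : ‖h‖ ≤ Real.sinh ‖h‖ := Real.self_le_sinh_iff.2 (norm_nonneg h)
  have hexp := Real.cosh_add_sinh ‖h‖
  rcases eq_or_ne x 0 with rfl | hx
  · simp only [zero_add, norm_zero, Real.cosh_zero, inner_zero_left, mul_zero, add_zero, one_mul]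
    linarith
  rcases eq_or_ne h 0 with rfl | hh
  · simp
  have ha : 0 < ‖x‖ := norm_pos_iff.2 hx
  have hb : 0 < ‖h‖ := norm_pos_iff.2 hh
  have hc := abs_le.1 (abs_real_inner_le_norm x h)
  have hsq : ‖x + h‖ ^ 2 = ‖x‖ ^ 2 + 2 * ⟪x, h⟫ + ‖h‖ ^ 2 := norm_add_sq_real x h
  generalize ⟪x, h⟫ = c at *
  set a := ‖x‖
  set b := ‖h‖
  -- `‖x + h‖²` is the convex combination of `(a - b)²` and `(a + b)²` with this weight
  obtain ⟨t, ht⟩ : ∃ t, t = c / (a * b) := ⟨_, rfl⟩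
  have hct : c = t * (a * b) := by rw [ht]; field_simp
  have hab : 0 < a * b := by positivity
  have ht1 : t ≤ 1 := by rw [ht, div_le_one hab]; exact hc.2
  have ht0 : -1 ≤ t := by rw [ht, le_div_iff₀ hab]; linarith [hc.1]
  have key := cosh_sqrt_convex (p := (1 + t) / 2) (u := a - b) (v := a + b) (by linarith)
    (by linarith)
  rw [show (1 - (1 + t) / 2) * (a - b) ^ 2 + (1 + t) / 2 * (a + b) ^ 2 = ‖x + h‖ ^ 2 by
    rw [hsq, hct]; ring, Real.sqrt_sq (norm_nonneg _), Real.cosh_sub, Real.cosh_add] at key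
  have e1 : Real.sinh a / a * c = Real.sinh a * (t * b) := by rw [hct]; field_simp
  rw [e1]
  have hsa : 0 ≤ Real.sinh a := Real.sinh_nonneg_iff.2 ha.le
  have hsc : Real.sinh a ≤ Real.cosh a := (Real.sinh_lt_cosh a).le
  have h1 : Real.sinh a * (t * (Real.sinh b - b)) ≤ Real.cosh a * (Real.sinh b - b) := by
    calc Real.sinh a * (t * (Real.sinh b - b)) ≤ Real.sinh a * (1 * (Real.sinh b - b)) := by
          gcongr
      _ ≤ Real.cosh a * (Real.sinh b - b) := by
          rw [one_mul]; gcongr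
  have h2 : Real.exp b = Real.cosh b + Real.sinh b := hexp.symm
  rw [h2]
  nlinarith

/-- A nonnegative function `Φ` whose mean a centred noise of variance proxy `s²`, added to the
argument, multiplies by at most `exp (lam² s²)`: `growth` serves for large `s`, and `firstOrder`,
the linear term of which averages out, for small `s`. The instances of interest are
`x ↦ exp ⟪u, x⟫`, with `lam = ‖u‖`, and `x ↦ cosh (lam ‖x‖)`. -/
structure IsExpTest (Φ : E → ℝ) (lam : ℝ) : Prop where
  continuous : Continuous Φ
  nonneg : ∀ x, 0 ≤ Φ x
  growth : ∀ x h, Φ (x + h) ≤ Φ x * Real.exp (lam * ‖h‖)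
  firstOrder : ∀ x, ∃ c : E, ∀ h, Φ (x + h) ≤ Φ x * Real.exp (lam ^ 2 * ‖h‖ ^ 2) + ⟪c, h⟫

theorem isExpTest_exp_inner (u : E) : IsExpTest (fun x => Real.exp ⟪u, x⟫) ‖u‖ where
  continuous := by fun_prop
  nonneg x := (Real.exp_pos _).le
  growth x h := by
    rw [inner_add_right, Real.exp_add]
    gcongr
    exact real_inner_le_norm u h
  firstOrder x := by
    refine ⟨Real.exp ⟪u, x⟫ • u, fun h => ?_⟩
    rw [inner_add_right, Real.exp_add, real_inner_smul_left, ← mul_add]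
    have h1 := exp_le_self_add_exp_sq ⟪u, h⟫
    have h2 : ⟪u, h⟫ ^ 2 ≤ ‖u‖ ^ 2 * ‖h‖ ^ 2 := by
      rw [← mul_pow, ← sq_abs]
      exact pow_le_pow_left₀ (abs_nonneg _) (abs_real_inner_le_norm u h) 2
    gcongr
    linarith [Real.exp_le_exp.2 h2]

theorem isExpTest_cosh_norm {lam : ℝ} (hlam : 0 ≤ lam) :
    IsExpTest (fun x : E => Real.cosh (lam * ‖x‖)) lam where
  continuous := Real.continuous_cosh.comp (by fun_prop)
  nonneg x := (Real.cosh_pos _).le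
  growth x h := by
    have h1 : Real.cosh (lam * ‖x + h‖) ≤ Real.cosh (lam * ‖x‖ + lam * ‖h‖) := by
      rw [Real.cosh_le_cosh, abs_of_nonneg (by positivity), abs_of_nonneg (by positivity),
        ← mul_add]
      exact mul_le_mul_of_nonneg_left (norm_add_le x h) hlam
    rw [Real.cosh_add] at h1
    rw [← Real.cosh_add_sinh (lam * ‖h‖), mul_add]
    have h2 : Real.sinh (lam * ‖x‖) * Real.sinh (lam * ‖h‖)
        ≤ Real.cosh (lam * ‖x‖) * Real.sinh (lam * ‖h‖) :=
      mul_le_mul_of_nonneg_right (Real.sinh_lt_cosh _).le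
        (Real.sinh_nonneg_iff.2 (by positivity))
    linarith
  firstOrder x := by
    refine ⟨(Real.sinh ‖lam • x‖ / ‖lam • x‖ * lam ^ 2) • x, fun h => ?_⟩
    have hn : ∀ y : E, lam * ‖y‖ = ‖lam • y‖ := fun y => by
      rw [norm_smul, Real.norm_of_nonneg hlam]
    have h1 := cosh_norm_add_le (lam • x) (lam • h)
    rw [← smul_add, inner_smul_left, inner_smul_right] at h1
    rw [← mul_pow, hn, hn, hn, inner_smul_left]
    have h2 := exp_le_self_add_exp_sq ‖lam • h‖
    have h3 : Real.cosh ‖lam • x‖ * (Real.exp ‖lam • h‖ - ‖lam • h‖)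
        ≤ Real.cosh ‖lam • x‖ * Real.exp (‖lam • h‖ ^ 2) := by
      have := (Real.cosh_pos ‖lam • x‖).le
      gcongr
      linarith
    simp only [conj_trivial] at h1 ⊢
    linarith

end ExpTest

/-! ### Centred noise with a variance proxy -/

section Noise

variable {E : Type*} [NormedAddCommGroup E] [InnerProductSpace ℝ E] [MeasurableSpace E]
  [BorelSpace E] {Ω : Type*} [MeasurableSpace Ω] {P : Measure Ω}

/-- A bounded centred random vector whose squared norm is sub-exponential with variance proxy
`s²`. The range `a * s² ≤ 1` in place of the single exponent `a = s⁻²` admits `s = 0`. -/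
structure IsNoise (P : Measure Ω) (ζ : Ω → E) (s : ℝ) : Prop where
  measurable : Measurable ζ
  bounded : ∃ C, ∀ ω, ‖ζ ω‖ ≤ C
  centred : ∫ ω, ζ ω ∂P = 0
  expSq : ∀ a, 0 ≤ a → a * s ^ 2 ≤ 1 → ∫ ω, Real.exp (a * ‖ζ ω‖ ^ 2) ∂P ≤ Real.exp (a * s ^ 2)

theorem IsNoise.smul {ζ : Ω → E} {s : ℝ} (h : IsNoise P ζ s) (k : ℝ) :
    IsNoise P (fun ω => k • ζ ω) (k * s) where
  measurable := h.measurable.const_smul k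
  bounded := by
    obtain ⟨C, hC⟩ := h.bounded
    refine ⟨|k| * C, fun ω => ?_⟩
    rw [norm_smul, Real.norm_eq_abs]
    exact mul_le_mul_of_nonneg_left (hC ω) (abs_nonneg k)
  centred := by rw [integral_smul, h.centred, smul_zero]
  expSq a ha has := by
    have := h.expSq (a * k ^ 2) (by positivity) (by rw [mul_assoc, ← mul_pow]; exact has)
    rw [mul_assoc, ← mul_pow] at this
    refine le_trans (le_of_eq ?_) this
    refine integral_congr_ae (.of_forall fun ω => ?_)
    dsimp only
    rw [norm_smul, mul_pow, Real.norm_eq_abs, sq_abs, mul_assoc]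

variable [IsProbabilityMeasure P]

theorem integrable_of_abs_le {F : Ω → ℝ} (hF : Measurable F) {C : ℝ} (h : ∀ ω, |F ω| ≤ C) :
    Integrable F P :=
  Integrable.of_bound hF.aestronglyMeasurable C (.of_forall h)

theorem integrable_exp_norm_sq {F : Type*} [NormedAddCommGroup F] [MeasurableSpace F]
    [BorelSpace F] {ζ : Ω → F} (hζ : Measurable ζ) {C : ℝ} (hC : ∀ ω, ‖ζ ω‖ ≤ C)
    {a : ℝ} (ha : 0 ≤ a) : Integrable (fun ω => Real.exp (a * ‖ζ ω‖ ^ 2)) P := by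
  refine integrable_of_abs_le (C := Real.exp (a * C ^ 2)) (by fun_prop) fun ω => ?_
  rw [abs_of_pos (Real.exp_pos _)]
  have := hC ω
  gcongr

theorem isNoise_of_norm_le {ζ : Ω → E} {s : ℝ} (hm : Measurable ζ) (h0 : ∫ ω, ζ ω ∂P = 0)
    (hs : ∀ ω, ‖ζ ω‖ ^ 2 ≤ s ^ 2) : IsNoise P ζ s where
  measurable := hm
  bounded := ⟨|s|, fun ω => by simpa using sq_le_sq.1 (hs ω)⟩
  centred := h0
  expSq a ha _ := by
    have hb : ∀ ω, ‖ζ ω‖ ≤ |s| := fun ω => by simpa using sq_le_sq.1 (hs ω)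
    calc ∫ ω, Real.exp (a * ‖ζ ω‖ ^ 2) ∂P ≤ ∫ _, Real.exp (a * s ^ 2) ∂P := by
          refine integral_mono (integrable_exp_norm_sq hm hb ha) (integrable_const _) fun ω => ?_
          have := hs ω
          dsimp only
          gcongr
      _ = Real.exp (a * s ^ 2) := by simp

/-- The condition `𝔼 exp (‖ζ‖² / s²) ≤ e` implies the one with smaller exponents, by the tangent
form of Jensen's inequality. -/
theorem isNoise_of_integral_exp_le {ζ : Ω → E} {s : ℝ} (hspos : 0 < s) (hm : Measurable ζ)
    (hb : ∃ C, ∀ ω, ‖ζ ω‖ ≤ C) (h0 : ∫ ω, ζ ω ∂P = 0)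
    (hs : ∫ ω, Real.exp (‖ζ ω‖ ^ 2 / s ^ 2) ∂P ≤ Real.exp 1) : IsNoise P ζ s where
  measurable := hm
  bounded := hb
  centred := h0
  expSq a ha has := by
    obtain ⟨C, hC⟩ := hb
    set p := a * s ^ 2 with hp
    have hp0 : 0 ≤ p := by positivity
    have hint : Integrable (fun ω => Real.exp (‖ζ ω‖ ^ 2 / s ^ 2)) P := by
      have := integrable_exp_norm_sq (P := P) hm hC (a := (s ^ 2)⁻¹) (by positivity)
      simpa only [div_eq_inv_mul] using this
    calc ∫ ω, Real.exp (a * ‖ζ ω‖ ^ 2) ∂P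
        ≤ ∫ ω, Real.exp p * (p * (Real.exp (-1) * Real.exp (‖ζ ω‖ ^ 2 / s ^ 2)) + (1 - p)) ∂P := by
          refine integral_mono (integrable_exp_norm_sq hm hC ha)
            ((((hint.const_mul _).const_mul _).add (integrable_const _)).const_mul _) fun ω => ?_
          have hX : a * ‖ζ ω‖ ^ 2 = p + p * (‖ζ ω‖ ^ 2 / s ^ 2 - 1) := by
            rw [hp]; field_simp; ring
          have hconv := convexOn_exp.2 (Set.mem_univ (‖ζ ω‖ ^ 2 / s ^ 2 - 1))
            (Set.mem_univ (0 : ℝ)) hp0 (by linarith : 0 ≤ 1 - p) (by ring)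
          simp only [smul_eq_mul, mul_zero, add_zero, Real.exp_zero, mul_one] at hconv
          dsimp only
          rw [← Real.exp_add, hX, Real.exp_add, neg_add_eq_sub]
          gcongr
      _ = Real.exp p * (p * (Real.exp (-1) * ∫ ω, Real.exp (‖ζ ω‖ ^ 2 / s ^ 2) ∂P) + (1 - p)) := by
          rw [integral_const_mul, integral_add ((hint.const_mul _).const_mul _)
            (integrable_const _), integral_const_mul, integral_const_mul]
          simp
      _ ≤ Real.exp p * (p * (Real.exp (-1) * Real.exp 1) + (1 - p)) := by gcongr
      _ = Real.exp p := by rw [← Real.exp_add]; simp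

theorem IsExpTest.integrable_comp_add {Φ : E → ℝ} {lam : ℝ} (hΦ : IsExpTest Φ lam)
    (hlam : 0 ≤ lam) {ζ : Ω → E} {s : ℝ} (hζ : IsNoise P ζ s) (x : E) :
    Integrable (fun ω => Φ (x + ζ ω)) P := by
  obtain ⟨C, hC⟩ := hζ.bounded
  refine integrable_of_abs_le (C := Φ x * Real.exp (lam * C))
    (hΦ.continuous.measurable.comp (hζ.measurable.const_add x)) fun ω => ?_
  rw [abs_of_nonneg (hΦ.nonneg _)]
  refine (hΦ.growth _ _).trans (mul_le_mul_of_nonneg_left ?_ (hΦ.nonneg x))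
  have := hC ω
  gcongr

variable [CompleteSpace E] [SecondCountableTopology E]

/-- One centred increment multiplies a test function in the mean by at most `exp (lam² s²)`. -/
theorem IsExpTest.integral_add_le {Φ : E → ℝ} {lam : ℝ} (hΦ : IsExpTest Φ lam)
    (hlam : 0 ≤ lam) {ζ : Ω → E} {s : ℝ} (hζ : IsNoise P ζ s) (x : E) :
    ∫ ω, Φ (x + ζ ω) ∂P ≤ Φ x * Real.exp (lam ^ 2 * s ^ 2) := by
  obtain ⟨C, hC⟩ := hζ.bounded
  have hint := hΦ.integrable_comp_add hlam hζ x
  have hζi : Integrable ζ P :=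
    Integrable.of_bound hζ.measurable.aestronglyMeasurable C (.of_forall hC)
  have hx := hΦ.nonneg x
  rcases le_or_gt (lam ^ 2 * s ^ 2) 1 with h | h
  -- small variance: the first order bound, the linear term of which has mean zero
  · obtain ⟨c, hc⟩ := hΦ.firstOrder x
    have he := integrable_exp_norm_sq (P := P) hζ.measurable hC (sq_nonneg lam)
    calc ∫ ω, Φ (x + ζ ω) ∂P
        ≤ ∫ ω, (Φ x * Real.exp (lam ^ 2 * ‖ζ ω‖ ^ 2) + ⟪c, ζ ω⟫) ∂P :=
          integral_mono hint ((he.const_mul _).add (hζi.const_inner c)) fun ω => hc _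
      _ = Φ x * ∫ ω, Real.exp (lam ^ 2 * ‖ζ ω‖ ^ 2) ∂P := by
          rw [integral_add (he.const_mul _) (hζi.const_inner c), integral_const_mul,
            integral_inner hζi, hζ.centred, inner_zero_right, add_zero]
      _ ≤ _ := by
          gcongr
          exact hζ.expSq _ (sq_nonneg lam) h
  -- large variance: the growth bound and Young's inequality suffice
  · have hs : s ≠ 0 := by
      rintro rfl
      norm_num at h
    have hy : ∀ ω, lam * ‖ζ ω‖ ≤ lam ^ 2 * s ^ 2 / 2 + (2 * s ^ 2)⁻¹ * ‖ζ ω‖ ^ 2 := fun ω => by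
      have e : lam ^ 2 * s ^ 2 / 2 + (2 * s ^ 2)⁻¹ * ‖ζ ω‖ ^ 2 - lam * ‖ζ ω‖
          = (lam * s ^ 2 - ‖ζ ω‖) ^ 2 / (2 * s ^ 2) := by
        field_simp
        ring
      have : 0 ≤ (lam * s ^ 2 - ‖ζ ω‖) ^ 2 / (2 * s ^ 2) := by positivity
      linarith
    have ha : 0 ≤ (2 * s ^ 2)⁻¹ := by positivity
    have he := integrable_exp_norm_sq (P := P) hζ.measurable hC ha
    have e2 : (2 * s ^ 2)⁻¹ * s ^ 2 = 1 / 2 := by field_simp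
    calc ∫ ω, Φ (x + ζ ω) ∂P
        ≤ ∫ ω, Φ x * Real.exp (lam ^ 2 * s ^ 2 / 2)
            * Real.exp ((2 * s ^ 2)⁻¹ * ‖ζ ω‖ ^ 2) ∂P := by
          refine integral_mono hint (he.const_mul _) fun ω => (hΦ.growth _ _).trans ?_
          rw [mul_assoc, ← Real.exp_add]
          have := hy ω
          gcongr
      _ = Φ x * Real.exp (lam ^ 2 * s ^ 2 / 2)
            * ∫ ω, Real.exp ((2 * s ^ 2)⁻¹ * ‖ζ ω‖ ^ 2) ∂P := integral_const_mul _ _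
      _ ≤ Φ x * Real.exp (lam ^ 2 * s ^ 2 / 2) * Real.exp (1 / 2) := by
          gcongr
          exact (hζ.expSq _ ha (by rw [e2]; norm_num)).trans_eq (by rw [e2])
      _ ≤ Φ x * Real.exp (lam ^ 2 * s ^ 2) := by
          rw [mul_assoc, ← Real.exp_add]
          gcongr
          linarith

theorem IsExpTest.lintegral_add_le {Φ : E → ℝ} {lam : ℝ} (hΦ : IsExpTest Φ lam)
    (hlam : 0 ≤ lam) {ζ : Ω → E} {s : ℝ} (hζ : IsNoise P ζ s) (x : E) :
    ∫⁻ ω, ENNReal.ofReal (Φ (x + ζ ω)) ∂P ≤ ENNReal.ofReal (Φ x * Real.exp (lam ^ 2 * s ^ 2)) := by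
  rw [← ofReal_integral_eq_lintegral_ofReal (hΦ.integrable_comp_add hlam hζ x)
    (.of_forall fun ω => hΦ.nonneg _)]
  exact ENNReal.ofReal_le_ofReal (hΦ.integral_add_le hlam hζ x)

/-- The same for the sum of `m` independent increments. -/
theorem IsExpTest.lintegral_sum_le {Φ : E → ℝ} {lam : ℝ} (hΦ : IsExpTest Φ lam)
    (hlam : 0 ≤ lam) {ζ : Ω → E} {s : ℝ} (hζ : IsNoise P ζ s) (m : ℕ) (x : E) :
    ∫⁻ ω : Fin m → Ω, ENNReal.ofReal (Φ (x + ∑ i, ζ (ω i))) ∂(Measure.pi fun _ => P)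
      ≤ ENNReal.ofReal (Φ x * Real.exp (lam ^ 2 * (m * s ^ 2))) := by
  induction m generalizing x with
  | zero => simp
  | succ m ih =>
    rw [← (measurePreserving_piFinSuccAbove (fun _ : Fin (m + 1) => P) 0).symm.lintegral_comp_emb
      (MeasurableEquiv.measurableEmbedding _)]
    refine (lintegral_prod_le _).trans ?_
    calc ∫⁻ a, ∫⁻ ω : Fin m → Ω, ENNReal.ofReal (Φ (x + ∑ i, ζ
            ((MeasurableEquiv.piFinSuccAbove (fun _ => Ω) 0).symm (a, ω) i)))
              ∂(Measure.pi fun _ => P) ∂P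
        ≤ ∫⁻ a, ENNReal.ofReal (Φ (x + ζ a)) *
            ENNReal.ofReal (Real.exp (lam ^ 2 * (m * s ^ 2))) ∂P := by
          refine lintegral_mono fun a => ?_
          dsimp only
          rw [← ENNReal.ofReal_mul (hΦ.nonneg _)]
          refine le_trans (le_of_eq ?_) (ih (x + ζ a))
          refine lintegral_congr fun ω => ?_
          simp [Fin.sum_univ_succ, MeasurableEquiv.piFinSuccAbove, add_assoc]
      _ ≤ ENNReal.ofReal (Φ x * Real.exp (lam ^ 2 * s ^ 2)) *
            ENNReal.ofReal (Real.exp (lam ^ 2 * (m * s ^ 2))) := by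
          rw [lintegral_mul_const' _ _ ENNReal.ofReal_ne_top]
          gcongr
          exact hΦ.lintegral_add_le hlam hζ x
      _ = _ := by
          rw [← ENNReal.ofReal_mul (mul_nonneg (hΦ.nonneg x) (Real.exp_pos _).le), mul_assoc,
            ← Real.exp_add]
          congr 3
          push_cast
          ring

end Noise

/-! ### Quantization noise -/

section Quantization

variable {n : ℕ}

theorem plusPart_apply (v : Vec n) (k : Fin n) : plusPart v k = max 0 (v k) := rfl

theorem plusPart_nonneg (v : Vec n) (k : Fin n) : 0 ≤ plusPart v k := le_max_left _ _

theorem norm1_plusPart (v : Vec n) : norm1 (plusPart v) = ∑ k, plusPart v k :=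
  Finset.sum_congr rfl fun k _ => abs_of_nonneg (plusPart_nonneg v k)

theorem norm1_plusPart_nonneg (v : Vec n) : 0 ≤ norm1 (plusPart v) :=
  Finset.sum_nonneg fun _ _ => abs_nonneg _

theorem plusPart_sub_plusPart_neg (v : Vec n) : plusPart v - plusPart (-v) = v := by
  ext k
  simp only [PiLp.sub_apply, plusPart_apply, PiLp.neg_apply]
  rcases le_total 0 (v k) with h | h
  · rw [max_eq_right h, max_eq_left (by linarith), sub_zero]
  · rw [max_eq_left h, max_eq_right (by linarith)]
    ring

theorem norm1_plusPart_add_neg (v : Vec n) :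
    norm1 (plusPart v) + norm1 (plusPart (-v)) = norm1 v := by
  rw [norm1_plusPart, norm1_plusPart, ← Finset.sum_add_distrib]
  refine Finset.sum_congr rfl fun k _ => ?_
  simp only [plusPart_apply, PiLp.neg_apply]
  rcases le_total 0 (v k) with h | h
  · rw [max_eq_right h, max_eq_left (by linarith), add_zero, abs_of_nonneg h]
  · rw [max_eq_left h, max_eq_right (by linarith), zero_add, abs_of_nonpos h]

theorem measurable_plusPart_apply (k : Fin n) : Measurable fun v : Vec n => plusPart v k := by
  simp only [plusPart_apply]
  fun_prop

theorem measurable_norm1_plusPart : Measurable fun v : Vec n => norm1 (plusPart v) := by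
  simp only [norm1_plusPart]
  exact Finset.measurable_sum _ fun k _ => measurable_plusPart_apply k

theorem measurable_catProb (k : Fin n) : Measurable fun v : Vec n => catProb v k :=
  (measurable_plusPart_apply k).div measurable_norm1_plusPart

theorem catProb_nonneg (v : Vec n) (k : Fin n) : 0 ≤ catProb v k :=
  div_nonneg (plusPart_nonneg v k) (norm1_plusPart_nonneg v)

theorem sum_catProb {v : Vec n} (hv : norm1 (plusPart v) ≠ 0) : ∑ k, catProb v k = 1 := by
  simp only [catProb]
  rw [← Finset.sum_div, ← norm1_plusPart, div_self hv]

theorem sum_Iic_catProb_le_one {v : Vec n} (hv : norm1 (plusPart v) ≠ 0) (k : Fin n) :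
    ∑ j ∈ Finset.Iic k, catProb v j ≤ 1 := by
  rw [← sum_catProb hv]
  exact Finset.sum_le_sum_of_subset_of_nonneg (Finset.subset_univ _) fun j _ _ => catProb_nonneg v j

variable [NeZero n]

theorem measurable_catSample :
    Measurable fun p : Vec n × unitInterval => catSample p.1 p.2 := by
  classical
  -- the sample depends on finitely many measurable yes-no questions
  let dec : Vec n × unitInterval → Fin n → Bool :=
    fun p k => decide ((p.2 : ℝ) ≤ ∑ j ∈ Finset.Iic k, catProb p.1 j)
  let pick : (Fin n → Bool) → Fin n := fun b =>
    if h : (Finset.univ.filter fun k : Fin n => b k = true).Nonempty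
      then Finset.min' _ h else 0
  have hdec : Measurable dec := by
    refine measurable_pi_lambda _ fun k => ?_
    refine measurable_to_bool ?_
    have : (fun p : Vec n × unitInterval => dec p k) ⁻¹' {true}
        = {p | (p.2 : ℝ) ≤ ∑ j ∈ Finset.Iic k, catProb p.1 j} := by
      ext p
      simp [dec]
    rw [this]
    exact measurableSet_le (by fun_prop)
      (Finset.measurable_sum _ fun j _ => (measurable_catProb j).comp measurable_fst)
  have hpick : (fun p : Vec n × unitInterval => catSample p.1 p.2) = fun p => pick (dec p) := by
    funext p
    simp only [catSample, pick, dec, decide_eq_true_eq]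
  rw [hpick]
  exact (measurable_of_finite pick).comp hdec

/-- The distribution function of a sample. -/
theorem catSample_le_iff {v : Vec n} (hv : norm1 (plusPart v) ≠ 0) (u : unitInterval) (k : Fin n) :
    catSample v u ≤ k ↔ (u : ℝ) ≤ ∑ j ∈ Finset.Iic k, catProb v j := by
  have hne : (Finset.univ.filter
      fun k : Fin n => (u : ℝ) ≤ ∑ j ∈ Finset.Iic k, catProb v j).Nonempty := by
    refine ⟨⊤, ?_⟩
    simp only [Finset.mem_filter, Finset.mem_univ, true_and, Finset.Iic_top]
    rw [sum_catProb hv]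
    exact u.2.2
  rw [catSample, dif_pos hne]
  constructor
  · intro h
    have hm := Finset.min'_mem _ hne
    simp only [Finset.mem_filter, Finset.mem_univ, true_and] at hm
    exact hm.trans (Finset.sum_le_sum_of_subset_of_nonneg (Finset.Iic_subset_Iic.2 h)
      fun j _ _ => catProb_nonneg v j)
  · intro h
    exact Finset.min'_le _ _ (by simpa using h)

theorem measurable_catSample_right (v : Vec n) : Measurable (catSample v) :=
  measurable_catSample.comp measurable_prodMk_left

theorem volume_catSample_eq {v : Vec n} (hv : norm1 (plusPart v) ≠ 0) (k : Fin n) :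
    (volume : Measure unitInterval).real {u | catSample v u = k} = catProb v k := by
  have hcdf : ∀ k : Fin n,
      ∑ j ∈ Finset.Iic k, (volume : Measure unitInterval).real {u | catSample v u = j}
        = ∑ j ∈ Finset.Iic k, catProb v j := fun k => by
    rw [← measureReal_biUnion_finset]
    · have hset : (⋃ j ∈ Finset.Iic k, {u | catSample v u = j})
          = Set.Iic (⟨∑ j ∈ Finset.Iic k, catProb v j,
              Finset.sum_nonneg fun j _ => catProb_nonneg v j,
              sum_Iic_catProb_le_one hv k⟩ : unitInterval) := by
        ext u
        simp only [Finset.mem_Iic, Set.mem_iUnion, Set.mem_ofPred_eq, exists_prop,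
          exists_eq_right', Set.mem_Iic]
        rw [catSample_le_iff hv, ← Subtype.coe_le_coe]
      rw [hset, Measure.real, unitInterval.volume_Iic, ENNReal.toReal_ofReal]
      exact Finset.sum_nonneg fun j _ => catProb_nonneg v j
    · intro i _ j _ hij
      refine Set.disjoint_left.2 fun u hi hj => hij ?_
      rw [← hi, ← hj]
    · intro j _
      exact measurable_catSample_right v (measurableSet_singleton j)
  induction k using WellFoundedLT.induction with
  | ind k ih =>
    have h := hcdf k
    rw [← Finset.Iio_insert, Finset.sum_insert (by simp), Finset.sum_insert (by simp),
      Finset.sum_congr rfl fun j hj => ih j (Finset.mem_Iio.1 hj)] at h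
    exact add_right_cancel h

/-- The error `‖[v]₊‖₁ e_k - [v]₊` of one quantization sample. -/
noncomputable def quantNoise (v : Vec n) (u : unitInterval) : Vec n :=
  norm1 (plusPart v) • EuclideanSpace.single (catSample v u) (1 : ℝ) - plusPart v

theorem measurable_quantNoise (v : Vec n) : Measurable (quantNoise v) :=
by
  have h : Measurable fun u => EuclideanSpace.single (catSample v u) (1 : ℝ) :=
    (measurable_of_finite fun k : Fin n => EuclideanSpace.single k (1 : ℝ)).comp
      (measurable_catSample_right v)
  unfold quantNoise
  fun_prop

theorem norm_quantNoise_sq_le (v : Vec n) (u : unitInterval) :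
    ‖quantNoise v u‖ ^ 2 ≤ 4 * (1 - 1 / (n : ℝ)) * norm1 (plusPart v) ^ 2 := by
  set k := catSample v u with hk
  set p := norm1 (plusPart v) with hp
  have hp0 : 0 ≤ p := norm1_plusPart_nonneg v
  have hle : ∀ j, plusPart v j ≤ p := fun j => by
    rw [hp, norm1_plusPart]
    exact Finset.single_le_sum (fun i _ => plusPart_nonneg v i) (Finset.mem_univ j)
  rcases (Nat.one_le_iff_ne_zero.2 (NeZero.ne n)).eq_or_lt with h1 | h2
  -- in dimension one the quantization is exact
  · subst h1
    have : quantNoise v u = 0 := by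
      ext j
      have hj : catSample v u = j := Subsingleton.elim _ _
      simp only [quantNoise, PiLp.sub_apply, PiLp.smul_apply, PiLp.zero_apply, norm1_plusPart, hj]
      simp [Subsingleton.elim j 0]
    simp [this]
  · have hn : (2 : ℝ) ≤ n := by exact_mod_cast h2
    have hn2 : 1 / (n : ℝ) ≤ 1 / 2 := one_div_le_one_div_of_le (by norm_num) hn
    have ha : ‖plusPart v‖ ^ 2 ≤ p ^ 2 := by
      rw [EuclideanSpace.norm_sq_eq, sq p]
      calc ∑ j, ‖plusPart v j‖ ^ 2 ≤ ∑ j, plusPart v j * p := by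
            refine Finset.sum_le_sum fun j _ => ?_
            rw [Real.norm_of_nonneg (plusPart_nonneg v j), sq]
            exact mul_le_mul_of_nonneg_left (hle j) (plusPart_nonneg v j)
        _ = p * p := by rw [← Finset.sum_mul, ← norm1_plusPart]
    have hin : 0 ≤ ⟪p • EuclideanSpace.single k (1 : ℝ), plusPart v⟫ := by
      rw [real_inner_smul_left, EuclideanSpace.inner_single_left]
      simpa using mul_nonneg hp0 (plusPart_nonneg v k)
    have hs : ‖p • EuclideanSpace.single k (1 : ℝ)‖ ^ 2 = p ^ 2 := by
      rw [norm_smul, mul_pow]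
      simp
    rw [quantNoise, ← hk, ← hp, norm_sub_sq_real, hs]
    nlinarith [sq_nonneg p]

theorem integral_quantNoise (v : Vec n) : ∫ u, quantNoise v u = 0 := by
  by_cases hv : norm1 (plusPart v) = 0
  · have h0 : plusPart v = 0 := by
      ext k
      have := (Finset.sum_eq_zero_iff_of_nonneg fun j _ => plusPart_nonneg v j).1
        ((norm1_plusPart v).symm.trans hv) k (Finset.mem_univ k)
      simpa using this
    simp [quantNoise, h0, norm1]
  have hint : Integrable (quantNoise v) := by
    refine Integrable.of_bound (measurable_quantNoise v).aestronglyMeasurable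
      √(4 * (1 - 1 / (n : ℝ)) * norm1 (plusPart v) ^ 2) (.of_forall fun u => ?_)
    exact Real.le_sqrt_of_sq_le (norm_quantNoise_sq_le v u)
  ext k
  have h1 : (∫ u, quantNoise v u) k = ∫ u, quantNoise v u k :=
    ((EuclideanSpace.proj (𝕜 := ℝ) k).integral_comp_comm hint).symm
  have hm : MeasurableSet {u | catSample v u = k} :=
    measurable_catSample_right v (measurableSet_singleton k)
  have h2 : ∀ u, quantNoise v u k
      = {u | catSample v u = k}.indicator (fun _ => norm1 (plusPart v)) u - plusPart v k := by
    intro u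
    by_cases h : catSample v u = k
    · simp [quantNoise, h]
    · simp [quantNoise, h, Ne.symm h, Set.indicator]
  rw [h1, PiLp.zero_apply]
  simp_rw [h2]
  rw [integral_sub ((integrable_const _).indicator hm) (integrable_const _),
    integral_indicator_const _ hm, volume_catSample_eq hv]
  simp [catProb, hv]

theorem isNoise_quantNoise (v : Vec n) :
    IsNoise volume (quantNoise v) √(4 * (1 - 1 / (n : ℝ)) * norm1 (plusPart v) ^ 2) :=
  isNoise_of_norm_le (measurable_quantNoise v) (integral_quantNoise v) fun u => by
    rw [Real.sq_sqrt ((sq_nonneg _).trans (norm_quantNoise_sq_le v u))]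
    exact norm_quantNoise_sq_le v u

theorem pps_eq_add_sum_quantNoise {M : ℕ} (hM : 1 ≤ M) (G : Vec n) (u w : Fin M → unitInterval) :
    pps G u w = G + ∑ i, (1 / (M : ℝ)) • quantNoise G (u i)
      + ∑ i, (-(1 / (M : ℝ))) • quantNoise (-G) (w i) := by
  have hM' : (M : ℝ) ≠ 0 := by positivity
  have key : ∀ (v : Vec n) (u : Fin M → unitInterval),
      ∑ i, (1 / (M : ℝ)) • quantNoise v (u i)
        = (norm1 (plusPart v) / (M : ℝ)) • ∑ i, EuclideanSpace.single (catSample v (u i)) (1 : ℝ)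
          - plusPart v := fun v u => by
    simp only [quantNoise, smul_sub, Finset.sum_sub_distrib, ← Finset.smul_sum, smul_smul]
    congr 1
    · rw [one_div_mul_eq_div]
    · simp [← Nat.cast_smul_eq_nsmul ℝ, smul_smul, hM']
  simp only [neg_smul, Finset.sum_neg_distrib]
  rw [key, key, pps]
  have aux : ∀ a b P N : Vec n, P - N = G → a - b = G + (a - P) + -(b - N) := fun a b P N h => by
    rw [← h]
    abel
  exact aux _ _ _ _ (plusPart_sub_plusPart_neg G)

theorem measurable_pps {M : ℕ} :
    Measurable fun p : Vec n × (Fin M → unitInterval) × (Fin M → unitInterval) =>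
      pps p.1 p.2.1 p.2.2 := by
  -- the sampling function is a variable here, so that unification does not unfold it
  have key : ∀ S : Vec n → unitInterval → Fin n,
      (Measurable fun q : Vec n × unitInterval => S q.1 q.2) →
      Measurable fun p : Vec n × (Fin M → unitInterval) =>
        (norm1 (plusPart p.1) / (M : ℝ)) • ∑ i, EuclideanSpace.single (S p.1 (p.2 i)) (1 : ℝ) := by
    intro S hS
    have h1 : Measurable fun p : Vec n × (Fin M → unitInterval) => norm1 (plusPart p.1) :=
      measurable_norm1_plusPart.comp measurable_fst
    refine (h1.div_const _).smul (Finset.measurable_sum _ fun i _ => ?_)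
    have h2 : Measurable fun p : Vec n × (Fin M → unitInterval) => (p.1, p.2 i) := by fun_prop
    exact (measurable_of_finite fun k : Fin n => EuclideanSpace.single k (1 : ℝ)).comp (hS.comp h2)
  have key2 : ∀ F : Vec n × (Fin M → unitInterval) → Vec n, Measurable F →
      Measurable fun p : Vec n × (Fin M → unitInterval) × (Fin M → unitInterval) =>
        F (p.1, p.2.1) - F (-p.1, p.2.2) := by
    intro F hF
    have h1 : Measurable fun p : Vec n × (Fin M → unitInterval) × (Fin M → unitInterval) =>
        (p.1, p.2.1) := by fun_prop
    have h2 : Measurable fun p : Vec n × (Fin M → unitInterval) × (Fin M → unitInterval) =>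
        (-p.1, p.2.2) := by fun_prop
    exact (hF.comp h1).sub (hF.comp h2)
  exact key2 _ (key catSample measurable_catSample)

end Quantization

/-! ### The noise of the quantized oracle -/

section Oracle

variable {n : ℕ} {Ξ : Type*} {g : Vec n → Ξ → Vec n} {B : ℝ}

theorem norm_le_norm1 (v : Vec n) : ‖v‖ ≤ norm1 v := by
  have h0 : 0 ≤ norm1 v := Finset.sum_nonneg fun _ _ => abs_nonneg _
  refine le_of_sq_le_sq ?_ h0
  rw [EuclideanSpace.norm_sq_eq]
  calc ∑ i, ‖v i‖ ^ 2 ≤ ∑ i, |v i| * norm1 v := by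
        refine Finset.sum_le_sum fun i _ => ?_
        rw [Real.norm_eq_abs, sq]
        exact mul_le_mul_of_nonneg_left
          (Finset.single_le_sum (f := fun i => |v i|) (fun _ _ => abs_nonneg _) (Finset.mem_univ i))
          (abs_nonneg _)
    _ = norm1 v ^ 2 := by rw [← Finset.sum_mul, sq]; rfl

theorem norm1_minibatch_le {r : ℕ} (hr : 1 ≤ r) (hB : ∀ x ξ, norm1 (g x ξ) ≤ B) (x : Vec n)
    (ξ : Fin r → Ξ) : norm1 (minibatch g x ξ) ≤ B := by
  have hr' : (0 : ℝ) < r := by positivity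
  calc norm1 (minibatch g x ξ) ≤ ∑ k, 1 / (r : ℝ) * ∑ i, |g x (ξ i) k| := by
        refine Finset.sum_le_sum fun k _ => ?_
        simp only [minibatch, PiLp.smul_apply, smul_eq_mul, abs_mul, WithLp.ofLp_sum,
          Finset.sum_apply]
        rw [abs_of_pos (by positivity : 0 < 1 / (r : ℝ))]
        gcongr
        exact Finset.abs_sum_le_sum_abs _ _
    _ = 1 / (r : ℝ) * ∑ i, norm1 (g x (ξ i)) := by
        rw [← Finset.mul_sum, Finset.sum_comm]
        rfl
    _ ≤ 1 / (r : ℝ) * ∑ _i : Fin r, B := by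
        gcongr with i
        exact hB _ _
    _ = B := by
        simp
        field_simp

variable [MeasurableSpace Ξ] {P : Measure Ξ} [IsProbabilityMeasure P] {f : Vec n → ℝ} {σ : ℝ}

theorem IsGradientOracle.isNoise (hg : IsGradientOracle P f g σ B) (hσ : 0 < σ) (x : Vec n) :
    IsNoise P (fun ξ => g x ξ - gradient f x) σ := by
  have hm : Measurable (g x) := hg.measurable.comp measurable_prodMk_left
  have hb : ∀ ξ, ‖g x ξ‖ ≤ B := fun ξ => (norm_le_norm1 _).trans (hg.bounded x ξ)
  refine isNoise_of_integral_exp_le hσ (hm.sub_const _)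
    ⟨B + ‖gradient f x‖, fun ξ => (norm_sub_le _ _).trans (by gcongr; exact hb ξ)⟩ ?_
    (hg.subGaussian x)
  rw [integral_sub (Integrable.of_bound hm.aestronglyMeasurable B (.of_forall hb))
    (integrable_const _), hg.unbiased]
  simp

variable [NeZero n]

theorem measurable_ppsOracle (hg : Measurable (Function.uncurry g)) {r M : ℕ} :
    Measurable fun p : Vec n × Draw Ξ r M => ppsOracle g p.2 p.1 := by
  have hmini : Measurable fun p : Vec n × (Fin r → Ξ) => minibatch g p.1 p.2 := by
    have hsum : Measurable fun p : Vec n × (Fin r → Ξ) => ∑ i, g p.1 (p.2 i) := by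
      refine Finset.measurable_sum _ fun i _ => ?_
      have h : Measurable fun p : Vec n × (Fin r → Ξ) => (p.1, p.2 i) := by fun_prop
      exact hg.comp h
    exact hsum.const_smul (1 / (r : ℝ))
  have key : ∀ (m : Vec n × (Fin r → Ξ) → Vec n)
      (F : Vec n × (Fin M → unitInterval) × (Fin M → unitInterval) → Vec n),
      Measurable m → Measurable F →
      Measurable fun p : Vec n × Draw Ξ r M => F (m (p.1, p.2.1), p.2.2.1, p.2.2.2) := by
    intro m F hm hF
    have h1 : Measurable fun p : Vec n × Draw Ξ r M => (p.1, p.2.1) := by fun_prop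
    have h2 : Measurable fun p : Vec n × Draw Ξ r M => (p.2.2.1, p.2.2.2) := by fun_prop
    exact hF.comp ((hm.comp h1).prodMk h2)
  exact key _ _ hmini measurable_pps

/-- For a fixed mini-batch gradient `G`, quantization is a sum of `2 M` centred increments. -/
theorem lintegral_pps_le {Φ : Vec n → ℝ} {lam : ℝ} (hΦ : IsExpTest Φ lam) (hlam : 0 ≤ lam) {M : ℕ}
    (hM : 1 ≤ M) {G : Vec n} (hG : norm1 G ≤ B) (c : Vec n) :
    ∫⁻ d : (Fin M → unitInterval) × (Fin M → unitInterval),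
        ENNReal.ofReal (Φ (pps G d.1 d.2 - c))
        ∂((Measure.pi fun _ : Fin M => (volume : Measure unitInterval)).prod
          (Measure.pi fun _ : Fin M => (volume : Measure unitInterval)))
      ≤ ENNReal.ofReal (Φ (G - c) *
          Real.exp (lam ^ 2 * (4 * (1 - 1 / (n : ℝ)) * B ^ 2 / M))) := by
  set p := norm1 (plusPart G) with hp
  set q := norm1 (plusPart (-G)) with hq
  have hp0 : 0 ≤ p := norm1_plusPart_nonneg G
  have hq0 : 0 ≤ q := norm1_plusPart_nonneg (-G)
  have hpq : p + q ≤ B := (norm1_plusPart_add_neg G).trans_le hG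
  have hM' : (0 : ℝ) < M := by positivity
  have hn : (1 : ℝ) ≤ n := by exact_mod_cast Nat.one_le_iff_ne_zero.2 (NeZero.ne n)
  obtain ⟨κ, hκ⟩ : ∃ κ, κ = 4 * (1 - 1 / (n : ℝ)) := ⟨_, rfl⟩
  have hκ0 : 0 ≤ κ := by
    have : 1 / (n : ℝ) ≤ 1 := (div_le_one (by linarith)).2 hn
    rw [hκ]; linarith
  have hNp : IsNoise volume (fun u => (1 / (M : ℝ)) • quantNoise G u) (1 / M * √(κ * p ^ 2)) := by
    rw [hκ]; exact (isNoise_quantNoise G).smul _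
  have hNq : IsNoise volume (fun u => (-(1 / (M : ℝ))) • quantNoise (-G) u)
      (-(1 / M) * √(κ * q ^ 2)) := by
    rw [hκ]; exact (isNoise_quantNoise (-G)).smul _
  refine (lintegral_prod_le _).trans ?_
  calc ∫⁻ u : Fin M → unitInterval, ∫⁻ w : Fin M → unitInterval,
          ENNReal.ofReal (Φ (pps G u w - c)) ∂(Measure.pi fun _ => volume)
          ∂(Measure.pi fun _ => volume)
      ≤ ∫⁻ u : Fin M → unitInterval,
          ENNReal.ofReal (Φ ((G - c) + ∑ i, (1 / (M : ℝ)) • quantNoise G (u i)))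
          * ENNReal.ofReal (Real.exp (lam ^ 2 * (M * (-(1 / M) * √(κ * q ^ 2)) ^ 2)))
          ∂(Measure.pi fun _ => volume) := by
        refine lintegral_mono fun u => ?_
        rw [← ENNReal.ofReal_mul (hΦ.nonneg _)]
        refine le_trans (le_of_eq ?_) (hΦ.lintegral_sum_le hlam hNq M _)
        refine lintegral_congr fun w => ?_
        rw [pps_eq_add_sum_quantNoise hM]
        congr 2
        abel
    _ ≤ ENNReal.ofReal (Φ (G - c) * Real.exp (lam ^ 2 * (M * (1 / M * √(κ * p ^ 2)) ^ 2)))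
          * ENNReal.ofReal (Real.exp (lam ^ 2 * (M * (-(1 / M) * √(κ * q ^ 2)) ^ 2))) := by
        rw [lintegral_mul_const' _ _ ENNReal.ofReal_ne_top]
        gcongr
        exact hΦ.lintegral_sum_le hlam hNp M _
    _ ≤ _ := by
        rw [← ENNReal.ofReal_mul (mul_nonneg (hΦ.nonneg _) (Real.exp_pos _).le), mul_assoc,
          ← Real.exp_add, ← mul_add, ← hκ]
        refine ENNReal.ofReal_le_ofReal (mul_le_mul_of_nonneg_left ?_ (hΦ.nonneg _))
        refine Real.exp_le_exp.2 (mul_le_mul_of_nonneg_left ?_ (sq_nonneg lam))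
        rw [mul_pow, mul_pow, Real.sq_sqrt (by positivity), Real.sq_sqrt (by positivity)]
        have e : (M : ℝ) * ((1 / M) ^ 2 * (κ * p ^ 2)) + M * ((-(1 / (M : ℝ))) ^ 2 * (κ * q ^ 2))
            = κ * (p ^ 2 + q ^ 2) / M := by
          field_simp
        rw [e]
        have : p ^ 2 + q ^ 2 ≤ B ^ 2 := by nlinarith
        gcongr

/-- The error of the quantized oracle acts on test functions like a centred noise of variance
proxy `noiseVar / 9`. The factor `9` is what the constant `50` leaves after `e < 2.7777`. -/
theorem lintegral_ppsOracle_le (hg : IsGradientOracle P f g σ B) (hσ : 0 < σ) {r M : ℕ}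
    (hr : 1 ≤ r) (hM : 1 ≤ M) {Φ : Vec n → ℝ} {lam : ℝ} (hΦ : IsExpTest Φ lam) (hlam : 0 ≤ lam)
    (y : Vec n) :
    ∫⁻ d, ENNReal.ofReal (Φ (ppsOracle g d y - gradient f y)) ∂(drawLaw P r M)
      ≤ ENNReal.ofReal (Φ 0 * Real.exp (lam ^ 2 * (noiseVar n σ B r M / 9))) := by
  have hr' : (0 : ℝ) < r := by positivity
  have hM' : (0 : ℝ) < M := by positivity
  have hn : (1 : ℝ) ≤ n := by exact_mod_cast Nat.one_le_iff_ne_zero.2 (NeZero.ne n)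
  have hn1 : 0 ≤ 1 - 1 / (n : ℝ) := by
    have : 1 / (n : ℝ) ≤ 1 := (div_le_one (by linarith)).2 hn
    linarith
  have hN := (hg.isNoise hσ y).smul (1 / (r : ℝ))
  refine (lintegral_prod_le _).trans ?_
  calc ∫⁻ ξ : Fin r → Ξ, ∫⁻ e : (Fin M → unitInterval) × (Fin M → unitInterval),
          ENNReal.ofReal (Φ (ppsOracle g (ξ, e) y - gradient f y))
          ∂((Measure.pi fun _ : Fin M => (volume : Measure unitInterval)).prod
            (Measure.pi fun _ : Fin M => (volume : Measure unitInterval)))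
          ∂(Measure.pi fun _ : Fin r => P)
      ≤ ∫⁻ ξ : Fin r → Ξ,
          ENNReal.ofReal (Φ (0 + ∑ i, (1 / (r : ℝ)) • (g y (ξ i) - gradient f y)))
          * ENNReal.ofReal (Real.exp (lam ^ 2 * (4 * (1 - 1 / (n : ℝ)) * B ^ 2 / M)))
          ∂(Measure.pi fun _ : Fin r => P) := by
        refine lintegral_mono fun ξ => ?_
        rw [← ENNReal.ofReal_mul (hΦ.nonneg _)]
        have e : minibatch g y ξ - gradient f y
            = 0 + ∑ i, (1 / (r : ℝ)) • (g y (ξ i) - gradient f y) := by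
          rw [zero_add, ← Finset.smul_sum, Finset.sum_sub_distrib, smul_sub, minibatch]
          congr 1
          simp [← Nat.cast_smul_eq_nsmul ℝ, smul_smul, hr'.ne']
        rw [← e]
        exact lintegral_pps_le hΦ hlam hM (norm1_minibatch_le hr hg.bounded y ξ) _
    _ ≤ ENNReal.ofReal (Φ 0 * Real.exp (lam ^ 2 * (r * (1 / r * σ) ^ 2)))
          * ENNReal.ofReal (Real.exp (lam ^ 2 * (4 * (1 - 1 / (n : ℝ)) * B ^ 2 / M))) := by
        rw [lintegral_mul_const' _ _ ENNReal.ofReal_ne_top]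
        gcongr
        exact hΦ.lintegral_sum_le hlam hN r 0
    _ ≤ _ := by
        rw [← ENNReal.ofReal_mul (mul_nonneg (hΦ.nonneg _) (Real.exp_pos _).le), mul_assoc,
          ← Real.exp_add, ← mul_add]
        refine ENNReal.ofReal_le_ofReal (mul_le_mul_of_nonneg_left ?_ (hΦ.nonneg _))
        refine Real.exp_le_exp.2 (mul_le_mul_of_nonneg_left ?_ (sq_nonneg lam))
        have e1 : (r : ℝ) * (1 / r * σ) ^ 2 = σ ^ 2 / r := by field_simp
        have e2 : 2 * (1 - 1 / (n : ℝ)) * B ^ 2 / (Real.exp 1 * M)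
            = (1 - 1 / (n : ℝ)) * B ^ 2 / M * (2 / Real.exp 1) := by field_simp
        have e3 : (18 : ℝ) / 25 ≤ 2 / Real.exp 1 := by
          rw [div_le_div_iff₀ (by norm_num) (Real.exp_pos _)]
          linarith [Real.exp_one_lt_d9]
        have hX : 0 ≤ (1 - 1 / (n : ℝ)) * B ^ 2 / M := by positivity
        have hY : 0 ≤ σ ^ 2 / r := by positivity
        rw [e1, noiseVar, e2, mul_assoc 4, mul_div_assoc 4]
        nlinarith [mul_le_mul_of_nonneg_left e3 hX]

theorem noiseVar_pos (hσ : 0 < σ) (B : ℝ) {r M : ℕ} (hr : 1 ≤ r) : 0 < noiseVar n σ B r M := by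
  have hr' : (0 : ℝ) < r := by positivity
  have hn : (1 : ℝ) ≤ n := by exact_mod_cast Nat.one_le_iff_ne_zero.2 (NeZero.ne n)
  have hn1 : 0 ≤ 1 - 1 / (n : ℝ) := by
    have : 1 / (n : ℝ) ≤ 1 := (div_le_one (by linarith)).2 hn
    linarith
  unfold noiseVar
  positivity

end Oracle

/-! ### Gaussian averaging -/

section Gaussian

/-- `exp (2 y² / v)` is the mean of `cosh (s y)` over a centred Gaussian `s` of variance `4 / v`. -/
theorem lintegral_cosh_gaussianReal {v : ℝ} (hv : 0 < v) (y : ℝ) :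
    ∫⁻ s, ENNReal.ofReal (Real.cosh (s * y)) ∂(gaussianReal 0 (4 / v).toNNReal)
      = ENNReal.ofReal (Real.exp (2 * y ^ 2 / v)) := by
  have hmgf : ∀ t : ℝ, ∫ s, Real.exp (t * s) ∂(gaussianReal 0 (4 / v).toNNReal)
      = Real.exp (2 * t ^ 2 / v) := fun t => by
    have h := mgf_gaussianReal (p := gaussianReal 0 (4 / v).toNNReal) (X := id)
      (μ := 0) (v := (4 / v).toNNReal) (by simp) t
    rw [mgf] at h
    simp only [id] at h
    rw [h, Real.coe_toNNReal _ (by positivity)]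
    congr 1
    field_simp
    ring
  have hint : ∀ t : ℝ, Integrable (fun s => Real.exp (t * s)) (gaussianReal 0 (4 / v).toNNReal) :=
    fun t => integrable_exp_mul_gaussianReal t
  have hc : ∀ s : ℝ, Real.cosh (s * y) = (Real.exp (y * s) + Real.exp (-y * s)) / 2 := fun s => by
    rw [Real.cosh_eq, mul_comm s y, neg_mul]
  have hi : Integrable (fun s => (Real.exp (y * s) + Real.exp (-y * s)) / 2)
      (gaussianReal 0 (4 / v).toNNReal) := ((hint y).add (hint (-y))).div_const 2
  simp_rw [hc]
  rw [← ofReal_integral_eq_lintegral_ofReal hi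
    (.of_forall fun s => by positivity), integral_div, integral_add (hint y) (hint (-y)), hmgf,
    hmgf, neg_sq]
  congr 1
  ring

theorem lintegral_exp_sq_gaussianReal {v : ℝ} (hv : 0 < v) :
    ∫⁻ s, ENNReal.ofReal (Real.exp (s ^ 2 * (v / 9))) ∂(gaussianReal 0 (4 / v).toNNReal)
      = ENNReal.ofReal 3 := by
  have h4 : 0 < 4 / v := by positivity
  have hne : (4 / v).toNNReal ≠ 0 := (Real.toNNReal_pos.2 h4).ne'
  rw [gaussianReal_of_var_ne_zero _ hne,
    lintegral_withDensity_eq_lintegral_mul _ (measurable_gaussianPDF _ _) (by fun_prop)]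
  have e : ∀ s : ℝ, (gaussianPDF 0 (4 / v).toNNReal
      * fun s : ℝ => ENNReal.ofReal (Real.exp (s ^ 2 * (v / 9)))) s
      = ENNReal.ofReal ((√(2 * Real.pi * (4 / v)))⁻¹ * Real.exp (-(v / 72) * s ^ 2)) := fun s => by
    rw [Pi.mul_apply, gaussianPDF, ← ENNReal.ofReal_mul (gaussianPDFReal_nonneg _ _ _),
      gaussianPDFReal, mul_assoc, ← Real.exp_add, Real.coe_toNNReal _ h4.le]
    congr 3
    field_simp
    ring
  simp_rw [e]
  have hint : Integrable fun s : ℝ => Real.exp (-(v / 72) * s ^ 2) :=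
    integrable_exp_neg_mul_sq (by positivity)
  rw [← ofReal_integral_eq_lintegral_ofReal (hint.const_mul _)
    (.of_forall fun s => by positivity), integral_const_mul, integral_gaussian]
  congr 1
  rw [show Real.pi / (v / 72) = 3 ^ 2 * (2 * Real.pi * (4 / v)) by field_simp; norm_num,
    Real.sqrt_mul (x := 3 ^ 2) (by norm_num), Real.sqrt_sq (by norm_num)]
  have : √(2 * Real.pi * (4 / v)) ≠ 0 := by positivity
  field_simp

variable {E : Type*} [NormedAddCommGroup E] [MeasurableSpace E]
  [BorelSpace E] {Ω : Type*} [MeasurableSpace Ω] {P : Measure Ω}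

/-- A bound for the Laplace transform of `‖η‖` becomes one for the exponential moment of `‖η‖²`. -/
theorem lintegral_exp_norm_sq_le [SFinite P] {η : Ω → E} (hη : Measurable η) {v : ℝ} (hv : 0 < v)
    (h : ∀ lam, 0 ≤ lam → ∫⁻ ω, ENNReal.ofReal (Real.cosh (lam * ‖η ω‖)) ∂P
      ≤ ENNReal.ofReal (Real.exp (lam ^ 2 * (v / 9)))) :
    ∫⁻ ω, ENNReal.ofReal (Real.exp (2 * ‖η ω‖ ^ 2 / v)) ∂P ≤ ENNReal.ofReal 3 := by
  simp_rw [← lintegral_cosh_gaussianReal hv]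
  rw [lintegral_lintegral_swap]
  · rw [← lintegral_exp_sq_gaussianReal hv]
    refine lintegral_mono fun s => ?_
    have := h |s| (abs_nonneg s)
    rw [sq_abs] at this
    refine le_trans (le_of_eq (lintegral_congr fun ω => ?_)) this
    rw [← Real.cosh_abs (s * ‖η ω‖), abs_mul, abs_norm]
  · have hc : Measurable Real.cosh := Real.continuous_cosh.measurable
    exact (ENNReal.measurable_ofReal.comp (hc.comp (by fun_prop))).aemeasurable

variable [InnerProductSpace ℝ E]

/-- Joint exponential moment of a linear and a quadratic function of the noise: the two are
separated by the weighted inequality `2 a b ≤ c a² + b² / c`, in the place of Cauchy-Schwarz. -/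
theorem lintegral_exp_inner_add_norm_sq_le [IsProbabilityMeasure P] {η : Ω → E}
    (hη : Measurable η) {v θ : ℝ} (u : E)
    (h1 : ∫⁻ ω, ENNReal.ofReal (Real.exp ⟪(2 : ℝ) • u, η ω⟫) ∂P
      ≤ ENNReal.ofReal (Real.exp (‖(2 : ℝ) • u‖ ^ 2 * (v / 9))))
    (h2 : ∫⁻ ω, ENNReal.ofReal (Real.exp (2 * ‖η ω‖ ^ 2 / v)) ∂P ≤ ENNReal.ofReal (Real.exp 2))
    (hθ : 0 ≤ θ) (hθ1 : θ ≤ 1) :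
    ∫⁻ ω, ENNReal.ofReal (Real.exp (⟪u, η ω⟫ + θ * (‖η ω‖ ^ 2 / v))) ∂P
      ≤ ENNReal.ofReal (Real.exp (2 / 9 * v * ‖u‖ ^ 2 + θ)) := by
  set p := 2 / 9 * v * ‖u‖ ^ 2 with hp
  have hpt : ∀ ω, Real.exp (⟪u, η ω⟫ + θ * (‖η ω‖ ^ 2 / v))
      ≤ Real.exp (θ - p) / 2 * Real.exp ⟪(2 : ℝ) • u, η ω⟫
        + (Real.exp (p + θ) / 2 * (θ * Real.exp (-2)) * Real.exp (2 * ‖η ω‖ ^ 2 / v)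
          + Real.exp (p + θ) / 2 * (1 - θ)) := fun ω => by
    rw [real_inner_smul_left]
    set X := ⟪u, η ω⟫
    obtain ⟨Z, hZ⟩ : ∃ Z, Z = 2 * ‖η ω‖ ^ 2 / v := ⟨_, rfl⟩
    have hY : θ * (‖η ω‖ ^ 2 / v) = θ * Z / 2 := by rw [hZ]; ring
    rw [hY, ← hZ]
    have hconv := convexOn_exp.2 (Set.mem_univ (Z - 2)) (Set.mem_univ (0 : ℝ)) hθ
      (sub_nonneg.2 hθ1) (by ring)
    simp only [smul_eq_mul, mul_zero, add_zero, Real.exp_zero, mul_one] at hconv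
    have hsep : 2 * Real.exp (X + θ * Z / 2)
        ≤ Real.exp (θ - p) * Real.exp (2 * X) + Real.exp (p - θ) * Real.exp (θ * Z) := by
      have e1 : Real.exp (θ - p) * Real.exp (2 * X) = Real.exp ((θ - p) / 2 + X) ^ 2 := by
        rw [← Real.exp_add, ← Real.exp_nat_mul]; congr 1; push_cast; ring
      have e2 : Real.exp (p - θ) * Real.exp (θ * Z) = Real.exp ((p - θ) / 2 + θ * Z / 2) ^ 2 := by
        rw [← Real.exp_add, ← Real.exp_nat_mul]; congr 1; push_cast; ring
      have e3 : Real.exp (X + θ * Z / 2)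
          = Real.exp ((θ - p) / 2 + X) * Real.exp ((p - θ) / 2 + θ * Z / 2) := by
        rw [← Real.exp_add]; congr 1; ring
      rw [e1, e2, e3]
      nlinarith [sq_nonneg (Real.exp ((θ - p) / 2 + X) - Real.exp ((p - θ) / 2 + θ * Z / 2))]
    have hJ : Real.exp (p - θ) * Real.exp (θ * Z)
        ≤ Real.exp (p + θ) * (θ * (Real.exp (-2) * Real.exp Z) + (1 - θ)) := by
      rw [← Real.exp_add, ← Real.exp_add,
        show p - θ + θ * Z = (p + θ) + θ * (Z - 2) by ring, Real.exp_add, neg_add_eq_sub]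
      gcongr
    linarith
  have hA : 0 ≤ Real.exp (p + θ) / 2 * (1 - θ) := mul_nonneg (by positivity) (sub_nonneg.2 hθ1)
  calc ∫⁻ ω, ENNReal.ofReal (Real.exp (⟪u, η ω⟫ + θ * (‖η ω‖ ^ 2 / v))) ∂P
      ≤ ∫⁻ ω, (ENNReal.ofReal (Real.exp (θ - p) / 2) * ENNReal.ofReal (Real.exp ⟪(2 : ℝ) • u, η ω⟫)
          + (ENNReal.ofReal (Real.exp (p + θ) / 2 * (θ * Real.exp (-2)))
              * ENNReal.ofReal (Real.exp (2 * ‖η ω‖ ^ 2 / v))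
            + ENNReal.ofReal (Real.exp (p + θ) / 2 * (1 - θ)))) ∂P := by
        refine lintegral_mono fun ω => (ENNReal.ofReal_le_ofReal (hpt ω)).trans (le_of_eq ?_)
        rw [ENNReal.ofReal_add (by positivity) (by positivity),
          ENNReal.ofReal_add (by positivity) hA, ENNReal.ofReal_mul (by positivity),
          ENNReal.ofReal_mul (p := Real.exp (p + θ) / 2 * (θ * Real.exp (-2))) (by positivity)]
    _ = ENNReal.ofReal (Real.exp (θ - p) / 2)
            * ∫⁻ ω, ENNReal.ofReal (Real.exp ⟪(2 : ℝ) • u, η ω⟫) ∂P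
          + (ENNReal.ofReal (Real.exp (p + θ) / 2 * (θ * Real.exp (-2)))
              * ∫⁻ ω, ENNReal.ofReal (Real.exp (2 * ‖η ω‖ ^ 2 / v)) ∂P
            + ENNReal.ofReal (Real.exp (p + θ) / 2 * (1 - θ))) := by
        have hq : Measurable fun ω => ENNReal.ofReal (Real.exp (2 * ‖η ω‖ ^ 2 / v)) := by fun_prop
        rw [lintegral_add_right _ ((hq.const_mul _).add_const _),
          lintegral_add_right _ measurable_const, lintegral_const_mul' _ _ ENNReal.ofReal_ne_top,
          lintegral_const_mul' _ _ ENNReal.ofReal_ne_top]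
        simp
    _ ≤ ENNReal.ofReal (Real.exp (θ - p) / 2)
            * ENNReal.ofReal (Real.exp (‖(2 : ℝ) • u‖ ^ 2 * (v / 9)))
          + (ENNReal.ofReal (Real.exp (p + θ) / 2 * (θ * Real.exp (-2)))
              * ENNReal.ofReal (Real.exp 2)
            + ENNReal.ofReal (Real.exp (p + θ) / 2 * (1 - θ))) := by
        gcongr
    _ = ENNReal.ofReal (Real.exp (p + θ)) := by
        rw [← ENNReal.ofReal_mul (by positivity), ← ENNReal.ofReal_mul (by positivity),
          ← ENNReal.ofReal_add (by positivity) hA,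
          ← ENNReal.ofReal_add (by positivity) (by positivity)]
        congr 1
        have e1 : ‖(2 : ℝ) • u‖ ^ 2 * (v / 9) = 2 * p := by
          rw [norm_smul, mul_pow, Real.norm_of_nonneg zero_le_two, hp]; ring
        have e2 : Real.exp (θ - p) * Real.exp (2 * p) = Real.exp (p + θ) := by
          rw [← Real.exp_add]; congr 1; ring
        have e3 : Real.exp (-2) * Real.exp 2 = 1 := by rw [← Real.exp_add]; simp
        rw [e1]
        linear_combination (1 / 2) * e2 + Real.exp (p + θ) / 2 * θ * e3

end Gaussian

/-- The exponential moment of the error of one oracle call that drives the analysis. -/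
theorem lintegral_exp_oracleError_le {n : ℕ} [NeZero n] {Ξ : Type*} [MeasurableSpace Ξ]
    {P : Measure Ξ} [IsProbabilityMeasure P] {f : Vec n → ℝ} {g : Vec n → Ξ → Vec n} {σ B : ℝ}
    (hg : IsGradientOracle P f g σ B) (hσ : 0 < σ) {r M : ℕ} (hr : 1 ≤ r) (hM : 1 ≤ M)
    (y u : Vec n) {θ : ℝ} (hθ : 0 ≤ θ) (hθ1 : θ ≤ 1) :
    ∫⁻ d, ENNReal.ofReal (Real.exp (⟪u, ppsOracle g d y - gradient f y⟫
        + θ * (‖ppsOracle g d y - gradient f y‖ ^ 2 / noiseVar n σ B r M))) ∂(drawLaw P r M)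
      ≤ ENNReal.ofReal (Real.exp (2 / 9 * noiseVar n σ B r M * ‖u‖ ^ 2 + θ)) := by
  have hm : Measurable fun d : Draw Ξ r M => ppsOracle g d y - gradient f y :=
    ((measurable_ppsOracle hg.measurable).comp measurable_prodMk_left).sub_const _
  have : IsProbabilityMeasure (drawLaw P r M) := by unfold drawLaw; infer_instance
  refine lintegral_exp_inner_add_norm_sq_le hm u ?_ ?_ hθ hθ1
  · simpa using lintegral_ppsOracle_le hg hσ hr hM (isExpTest_exp_inner ((2 : ℝ) • u))
      (norm_nonneg _) y
  · refine (lintegral_exp_norm_sq_le hm (noiseVar_pos hσ B hr) fun lam hlam => ?_).trans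
      (ENNReal.ofReal_le_ofReal ?_)
    · simpa using lintegral_ppsOracle_le hg hσ hr hM (isExpTest_cosh_norm hlam) hlam y
    · have := Real.add_one_le_exp (2 : ℝ)
      linarith

/-! ### Smooth convex functions -/

section Smooth

variable {n : ℕ} {f : Vec n → ℝ}

theorem hasDerivAt_comp_line (hd : Differentiable ℝ f) (x h : Vec n) (t : ℝ) :
    HasDerivAt (fun t : ℝ => f (x + t • h)) ⟪gradient f (x + t • h), h⟫ t := by
  have h1 : HasFDerivAt f (fderiv ℝ f (x + t • h)) (x + t • h) := (hd _).hasFDerivAt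
  have h2 : HasDerivAt (fun t : ℝ => x + t • h) h t := by
    simpa using ((hasDerivAt_id t).smul_const h).const_add x
  have h3 := h1.comp_hasDerivAt t h2
  rwa [← toDual_gradient, InnerProductSpace.toDual_apply_apply] at h3

theorem add_inner_gradient_le (hc : ConvexOn ℝ Set.univ f) (hd : Differentiable ℝ f)
    (x y : Vec n) : f x + ⟪gradient f x, y - x⟫ ≤ f y := by
  have hline : ConvexOn ℝ Set.univ fun t : ℝ => f (x + t • (y - x)) := by
    refine ⟨convex_univ, fun s _ t _ a b ha hb hab => ?_⟩
    have := hc.2 (Set.mem_univ (x + s • (y - x))) (Set.mem_univ (x + t • (y - x))) ha hb hab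
    refine le_trans (le_of_eq (congrArg f ?_)) this
    have hx : x = a • x + b • x := by rw [← add_smul, hab, one_smul]
    nth_rewrite 1 [hx]
    simp only [smul_add, add_smul, smul_smul, smul_eq_mul]
    abel
  have hder := hasDerivAt_comp_line hd x (y - x) 0
  have := hline.le_slope_of_hasDerivAt (Set.mem_univ 0) (Set.mem_univ 1) zero_lt_one hder
  simp only [slope_def_field, zero_smul, add_zero, one_smul, sub_zero, div_one,
    add_sub_cancel] at this
  linarith

theorem le_add_inner_gradient_add_sq {L : ℝ≥0} (hd : Differentiable ℝ f)
    (hL : LipschitzWith L (gradient f)) (x h : Vec n) :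
    f (x + h) ≤ f x + ⟪gradient f x, h⟫ + L / 2 * ‖h‖ ^ 2 := by
  set ψ : ℝ → ℝ := fun t => f (x + t • h) - (t * ⟪gradient f x, h⟫ + t ^ 2 * (L / 2 * ‖h‖ ^ 2))
    with hψ
  have hder : ∀ t : ℝ, HasDerivAt ψ (⟪gradient f (x + t • h), h⟫
      - (1 * ⟪gradient f x, h⟫ + (2 * t) * (L / 2 * ‖h‖ ^ 2))) t := fun t => by
    have h2 : HasDerivAt (fun t : ℝ => t ^ 2) (2 * t) t := by simpa using hasDerivAt_pow 2 t
    exact (hasDerivAt_comp_line hd x h t).sub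
      (((hasDerivAt_id t).mul_const _).add (h2.mul_const _))
  have hanti : AntitoneOn ψ (Set.Ici 0) := by
    refine antitoneOn_of_hasDerivWithinAt_nonpos (convex_Ici 0)
      (fun t _ => (hder t).continuousAt.continuousWithinAt)
      (fun t _ => (hder t).hasDerivWithinAt) fun t ht => ?_
    have ht0 : 0 < t := by simpa using ht
    have h1 : ⟪gradient f (x + t • h) - gradient f x, h⟫ ≤ L * (t * ‖h‖) * ‖h‖ := by
      refine (real_inner_le_norm _ _).trans (mul_le_mul_of_nonneg_right ?_ (norm_nonneg h))
      have := hL.norm_sub_le (x + t • h) x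
      rwa [add_sub_cancel_left, norm_smul, Real.norm_of_nonneg ht0.le] at this
    rw [inner_sub_left] at h1
    nlinarith
  have := hanti (Set.mem_Ici.2 le_rfl) (Set.mem_Ici.2 zero_le_one) zero_le_one
  simp only [hψ, zero_smul, add_zero, one_smul, one_mul, one_pow, zero_mul, zero_pow two_ne_zero,
    sub_zero] at this
  linarith

/-- Progress of a gradient step of length `c` with an inexact gradient `G`; the step length
condition leaves a fraction of the decrease to absorb the gradient error. -/
theorem gradient_step_le {L : ℝ≥0} (hd : Differentiable ℝ f) (hL : LipschitzWith L (gradient f))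
    {b c : ℝ} (hb : L < b) (hc : 0 ≤ c) (hcb : c * b ≤ 1) (y G : Vec n) :
    f (y - c • G) ≤ f y - c / 2 * ‖G‖ ^ 2 + ‖G - gradient f y‖ ^ 2 / (2 * (b - L)) := by
  have h1 := le_add_inner_gradient_add_sq hd hL y (-(c • G))
  rw [← sub_eq_add_neg, inner_neg_right, inner_smul_right, norm_neg, norm_smul,
    Real.norm_of_nonneg hc, mul_pow] at h1
  have hη : ⟪gradient f y, G⟫ = ‖G‖ ^ 2 - ⟪G - gradient f y, G⟫ := by
    rw [inner_sub_left, real_inner_self_eq_norm_sq]; ring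
  set η := G - gradient f y
  have hbL : 0 < b - L := sub_pos.2 hb
  have h2 : c * ⟪η, G⟫ ≤ c ^ 2 * (b - L) / 2 * ‖G‖ ^ 2 + ‖η‖ ^ 2 / (2 * (b - L)) := by
    have e : c ^ 2 * (b - L) / 2 * ‖G‖ ^ 2 + ‖η‖ ^ 2 / (2 * (b - L)) - c * (‖η‖ * ‖G‖)
        = (c * (b - L) * ‖G‖ - ‖η‖) ^ 2 / (2 * (b - L)) := by
      field_simp
      ring
    have : 0 ≤ (c * (b - L) * ‖G‖ - ‖η‖) ^ 2 / (2 * (b - L)) := by positivity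
    have := mul_le_mul_of_nonneg_left (real_inner_le_norm η G) hc
    linarith
  have h3 : c ^ 2 * b * ‖G‖ ^ 2 ≤ c * ‖G‖ ^ 2 := by
    rw [sq c, mul_assoc c c b]
    have := mul_le_mul_of_nonneg_left hcb hc
    rw [mul_one] at this
    gcongr
  rw [hη] at h1
  nlinarith

end Smooth

/-! ### The estimate sequence of the primal method -/

section Method

variable {n : ℕ} (α β : ℕ → ℝ) (query : ℕ → Vec n → Vec n)

/-- The point `y_t` at which the oracle call number `t` is made. -/
noncomputable def queryPoint : ℕ → Vec n
  | 0 => 0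
  | t + 1 =>
    (α (t + 1) / cumWeight α (t + 1)) • (-(1 / β t) • (primalState α β query t).1)
      + (1 - α (t + 1) / cumWeight α (t + 1)) • (primalState α β query t).2

/-- The prox-centre `z_{t-1}` in force before the oracle call number `t`; initially the origin. -/
noncomputable def proxCentre : ℕ → Vec n
  | 0 => 0
  | t + 1 => -(1 / β t) • (primalState α β query t).1

/-- The error `G_t - ∇f(y_t)` of the oracle call number `t`. -/
noncomputable def oracleError (f : Vec n → ℝ) (t : ℕ) : Vec n :=
  query t (queryPoint α β query t) - gradient f (queryPoint α β query t)

/-- The error accumulated in the calls `0, …, t - 1`: a martingale part, that is linear in the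
oracle errors, and a quadratic part. -/
noncomputable def errorSum (f : Vec n → ℝ) (xstar : Vec n) (L : ℝ) (t : ℕ) : ℝ :=
  ∑ s ∈ Finset.range t,
    (α s * ⟪oracleError α β query f s, xstar - proxCentre α β query s⟫
      + cumWeight α s / (2 * (β s - L)) * ‖oracleError α β query f s‖ ^ 2)

variable {α β} {L : ℝ≥0} {T : ℕ}

theorem cumWeight_succ (t : ℕ) : cumWeight α (t + 1) = cumWeight α t + α (t + 1) :=
  Finset.sum_range_succ _ _

theorem AdmissibleCoeffs.cumWeight_pos (h : AdmissibleCoeffs L T α β) {t : ℕ} (ht : t ≤ T) :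
    0 < cumWeight α t := by
  induction t with
  | zero => simpa [cumWeight] using h.zero_pos
  | succ t ih =>
    rw [cumWeight_succ]
    have := ih (by omega)
    have := h.nonneg (t + 1) ht
    linarith

theorem AdmissibleCoeffs.beta_pos (h : AdmissibleCoeffs L T α β) {t : ℕ} (ht : t ≤ T) :
    0 < β t :=
  L.2.trans_lt (h.lt_beta t ht)

/-- The primal method keeps the primal gap below the minimum of its estimate function, up to the
accumulated error. -/
theorem gap_add_le_errorSum (h : AdmissibleCoeffs L T α β) {f : Vec n → ℝ} {xstar : Vec n}
    (hc : ConvexOn ℝ Set.univ f) (hd : Differentiable ℝ f) (hL : LipschitzWith L (gradient f))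
    {t : ℕ} (ht : t ≤ T) :
    cumWeight α t * (f (primalState α β query t).2 - f xstar)
        + ‖(primalState α β query t).1‖ ^ 2 / (2 * β t) + ⟪(primalState α β query t).1, xstar⟫
      ≤ errorSum α β query f xstar L (t + 1) := by
  induction t with
  | zero =>
    have hβ := h.beta_pos (Nat.zero_le T)
    have hα := h.zero_pos
    have hstep := gradient_step_le hd hL (h.lt_beta 0 (Nat.zero_le T)) (c := α 0 / β 0)
      (by positivity) (by rw [div_mul_cancel₀ _ hβ.ne']; exact h.zero_le_one) 0 (query 0 0)
    have hconv := add_inner_gradient_le hc hd 0 xstar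
    simp only [errorSum, zero_add, Finset.range_one, Finset.sum_singleton, oracleError, queryPoint,
      proxCentre, sub_zero, primalState, neg_smul] at hconv hstep ⊢
    rw [zero_sub] at hstep
    have hA : cumWeight α 0 = α 0 := by simp [cumWeight]
    rw [hA, real_inner_smul_left, norm_smul, Real.norm_of_nonneg hα.le, inner_sub_left, mul_pow]
    have e1 : α 0 ^ 2 * ‖query 0 0‖ ^ 2 / (2 * β 0) = α 0 * (α 0 / β 0 / 2 * ‖query 0 0‖ ^ 2) := by
      field_simp
    have e2 : α 0 / (2 * (β 0 - L)) * ‖query 0 0 - gradient f 0‖ ^ 2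
        = α 0 * (‖query 0 0 - gradient f 0‖ ^ 2 / (2 * (β 0 - L))) := by ring
    rw [e1, e2]
    have m1 := mul_le_mul_of_nonneg_left hstep hα.le
    have m2 := mul_le_mul_of_nonneg_left hconv hα.le
    linarith
  | succ t ih =>
    have ht' : t < T := ht
    have ih := ih ht'.le
    have hβ := h.beta_pos ht'.le
    have hβ1 := h.beta_pos ht
    have hA := h.cumWeight_pos ht'.le
    have hA1 := h.cumWeight_pos ht
    have hα := h.nonneg (t + 1) ht
    have hAs := cumWeight_succ (α := α) t
    have hmono := h.beta_mono t ht'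
    rw [errorSum, Finset.sum_range_succ, ← errorSum]
    have hx : (primalState α β query (t + 1)).2 = queryPoint α β query (t + 1)
        - (α (t + 1) / cumWeight α (t + 1) * (α (t + 1) / β t))
            • query (t + 1) (queryPoint α β query (t + 1)) := by
      simp only [primalState, queryPoint]
      module
    have hs : (primalState α β query (t + 1)).1 = (primalState α β query t).1
        + α (t + 1) • query (t + 1) (queryPoint α β query (t + 1)) := rfl
    have hy : cumWeight α t • ((primalState α β query t).2 - queryPoint α β query (t + 1))
        = α (t + 1) • (queryPoint α β query (t + 1) - proxCentre α β query (t + 1)) := by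
      have e : cumWeight α (t + 1) • queryPoint α β query (t + 1)
          = α (t + 1) • proxCentre α β query (t + 1)
            + cumWeight α t • (primalState α β query t).2 := by
        simp only [queryPoint, proxCentre]
        rw [smul_add, smul_smul (cumWeight α (t + 1)), smul_smul (cumWeight α (t + 1)), mul_sub,
          mul_div_cancel₀ _ hA1.ne', mul_one, hAs, add_sub_cancel_right]
      rw [hAs, add_smul] at e
      rw [smul_sub, smul_sub, sub_eq_sub_iff_add_eq_add, ← sub_eq_zero]
      rw [← sub_eq_zero] at e
      rw [← neg_eq_zero, ← e]
      abel
    have hz : proxCentre α β query (t + 1) = -(1 / β t) • (primalState α β query t).1 := rfl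
    have hη : oracleError α β query f (t + 1)
        = query (t + 1) (queryPoint α β query (t + 1))
          - gradient f (queryPoint α β query (t + 1)) := rfl
    rw [hx, hs, hη]
    generalize proxCentre α β query (t + 1) = z at *
    generalize queryPoint α β query (t + 1) = y at *
    generalize query (t + 1) y = G at *
    generalize (primalState α β query t).1 = s at *
    generalize (primalState α β query t).2 = x at *
    generalize errorSum α β query f xstar L (t + 1) = S at *
    have hab := h.step t ht'
    have hlt := h.lt_beta (t + 1) ht
    generalize cumWeight α (t + 1) = A' at *
    generalize cumWeight α t = A at *
    generalize α (t + 1) = a at *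
    generalize β (t + 1) = b' at *
    generalize β t = b at *
    have hstep := gradient_step_le hd hL hlt (c := a / A' * (a / b)) (by positivity)
      (by
        rw [div_mul_div_comm, div_mul_eq_mul_div, div_le_one (by positivity)]
        linarith) y G
    have hcx := add_inner_gradient_le hc hd y x
    have hcs := add_inner_gradient_le hc hd y xstar
    have m1 := mul_le_mul_of_nonneg_left hstep hA1.le
    have m2 := mul_le_mul_of_nonneg_left hcx hA.le
    have m3 := mul_le_mul_of_nonneg_left hcs hα
    have i1 : A * ⟪gradient f y, x - y⟫ = a * ⟪gradient f y, y⟫ - a * ⟪gradient f y, z⟫ := by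
      rw [← inner_smul_right, hy, inner_smul_right, inner_sub_right]; ring
    have i2 : ⟪s, G⟫ = -b * ⟪G, z⟫ := by
      rw [hz, inner_smul_right, real_inner_comm]; field_simp
    have hn : ‖s + a • G‖ ^ 2 / (2 * b')
        ≤ ‖s‖ ^ 2 / (2 * b) - a * ⟪G, z⟫ + a ^ 2 / (2 * b) * ‖G‖ ^ 2 := by
      calc ‖s + a • G‖ ^ 2 / (2 * b') ≤ ‖s + a • G‖ ^ 2 / (2 * b) := by gcongr
        _ = _ := by
          rw [norm_add_sq_real, inner_smul_right, norm_smul, Real.norm_of_nonneg hα, mul_pow, i2]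
          field_simp
          ring
    have e1 : A' * (a / A' * (a / b) / 2 * ‖G‖ ^ 2) = a ^ 2 / (2 * b) * ‖G‖ ^ 2 := by
      field_simp
    have e2 : A' / (2 * (b' - L)) * ‖G - gradient f y‖ ^ 2
        = A' * (‖G - gradient f y‖ ^ 2 / (2 * (b' - L))) := by ring
    rw [e2, inner_add_left, real_inner_smul_left]
    simp only [inner_sub_left, inner_sub_right] at *
    subst hAs
    rw [mul_add, mul_sub, e1] at m1
    linarith

theorem gap_le_errorSum (h : AdmissibleCoeffs L T α β) {f : Vec n → ℝ} {xstar : Vec n}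
    (hc : ConvexOn ℝ Set.univ f) (hd : Differentiable ℝ f) (hL : LipschitzWith L (gradient f))
    {t : ℕ} (ht : t ≤ T) :
    cumWeight α t * (f (primalState α β query t).2 - f xstar)
        + β t / 2 * ‖xstar - proxCentre α β query (t + 1)‖ ^ 2
      ≤ β t / 2 * ‖xstar‖ ^ 2 + errorSum α β query f xstar L (t + 1) := by
  have h1 := gap_add_le_errorSum query h (xstar := xstar) hc hd hL ht
  have hβ := h.beta_pos ht
  have e : β t / 2 * ‖xstar - proxCentre α β query (t + 1)‖ ^ 2 = β t / 2 * ‖xstar‖ ^ 2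
      + ⟪(primalState α β query t).1, xstar⟫ + ‖(primalState α β query t).1‖ ^ 2 / (2 * β t) := by
    rw [proxCentre, neg_smul, sub_neg_eq_add, norm_add_sq_real, inner_smul_right, norm_smul,
      Real.norm_of_nonneg (by positivity), real_inner_comm]
    field_simp
  linarith

/-- The distance of the prox-centre from the minimiser is controlled by the accumulated error. (For
`t = 0` the index `t - 1` is `0` and the error sum is empty.) -/
theorem norm_sub_proxCentre_sq_le (h : AdmissibleCoeffs L T α β) {f : Vec n → ℝ} {xstar : Vec n}
    (hc : ConvexOn ℝ Set.univ f) (hd : Differentiable ℝ f) (hL : LipschitzWith L (gradient f))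
    (hmin : ∀ x, f xstar ≤ f x) {t : ℕ} (ht : t ≤ T) :
    ‖xstar - proxCentre α β query t‖ ^ 2
      ≤ ‖xstar‖ ^ 2 + 2 * errorSum α β query f xstar L t / β (t - 1) := by
  cases t with
  | zero => simp [proxCentre, errorSum]
  | succ t =>
    have ht' : t ≤ T := by omega
    have h1 := gap_le_errorSum query h (xstar := xstar) hc hd hL ht'
    have hβ := h.beta_pos ht'
    have h2 : 0 ≤ cumWeight α t * (f (primalState α β query t).2 - f xstar) :=
      mul_nonneg (h.cumWeight_pos ht').le (sub_nonneg.2 (hmin _))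
    rw [Nat.add_sub_cancel, ← sub_le_iff_le_add', le_div_iff₀ hβ]
    linarith

end Method

/-! ### The run of the method as a random process -/

section Run

variable {n : ℕ} [NeZero n] {Ξ Ω : Type*} [MeasurableSpace Ξ] [MeasurableSpace Ω]
  {g : Vec n → Ξ → Vec n} {α β : ℕ → ℝ} {r M : ℕ → ℕ} {d : (t : ℕ) → Ω → Draw Ξ (r t) (M t)}

theorem measurable_answer (hg : Measurable (Function.uncurry g)) {t : ℕ} (hd : Measurable (d t))
    {y : Ω → Vec n} (hy : Measurable y) : Measurable fun ω => ppsOracle g (d t ω) (y ω) := by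
  have key : ∀ F : Vec n × Draw Ξ (r t) (M t) → Vec n, Measurable F →
      Measurable fun ω => F (y ω, d t ω) := fun F hF => hF.comp (hy.prodMk hd)
  exact key _ (measurable_ppsOracle hg)

theorem measurable_primalState (hg : Measurable (Function.uncurry g)) {t : ℕ}
    (hd : ∀ s ≤ t, Measurable (d s)) :
    Measurable fun ω => primalState α β (fun s => ppsOracle g (d s ω)) t := by
  induction t with
  | zero =>
    have hG : Measurable fun ω => ppsOracle g (d 0 ω) 0 :=
      measurable_answer hg (hd 0 le_rfl) measurable_const
    simp only [primalState]
    fun_prop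
  | succ t ih =>
    have ih := ih fun s hs => hd s (hs.trans t.le_succ)
    have h1 := ih.fst
    have h2 := ih.snd
    have hz : Measurable fun ω =>
        -(1 / β t) • (primalState α β (fun s => ppsOracle g (d s ω)) t).1 :=
      h1.const_smul (-(1 / β t))
    have hy := (hz.const_smul (α (t + 1) / cumWeight α (t + 1))).add
      (h2.const_smul (1 - α (t + 1) / cumWeight α (t + 1)))
    have hG := measurable_answer hg (hd (t + 1) le_rfl) hy
    simp only [Pi.add_apply, Pi.smul_apply] at hG
    simp only [primalState]
    exact (h1.add (hG.const_smul (α (t + 1)))).prodMk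
      (((hz.sub (hG.const_smul (α (t + 1) / β t))).const_smul
        (α (t + 1) / cumWeight α (t + 1))).add
          (h2.const_smul (1 - α (t + 1) / cumWeight α (t + 1))))

variable (α β)

theorem measurable_queryPoint (hg : Measurable (Function.uncurry g)) {t : ℕ}
    (hd : ∀ s < t, Measurable (d s)) :
    Measurable fun ω => queryPoint α β (fun s => ppsOracle g (d s ω)) t := by
  cases t with
  | zero => exact measurable_const
  | succ t =>
    have h : Measurable fun ω => primalState α β (fun s => ppsOracle g (d s ω)) t :=
      measurable_primalState hg fun i hi => hd i (Nat.lt_succ_of_le hi)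
    have h1 := h.fst
    have h2 := h.snd
    simp only [queryPoint]
    fun_prop

theorem measurable_proxCentre (hg : Measurable (Function.uncurry g)) {t : ℕ}
    (hd : ∀ s < t, Measurable (d s)) :
    Measurable fun ω => proxCentre α β (fun s => ppsOracle g (d s ω)) t := by
  cases t with
  | zero => exact measurable_const
  | succ t =>
    exact (measurable_primalState hg fun i hi => hd i (Nat.lt_succ_of_le hi)).fst.const_smul
      (-(1 / β t))

theorem measurable_errorSum (hg : Measurable (Function.uncurry g)) {f : Vec n → ℝ}
    (hf : Measurable (gradient f)) (xstar : Vec n) (L : ℝ) {t : ℕ}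
    (hd : ∀ s < t, Measurable (d s)) :
    Measurable fun ω => errorSum α β (fun s => ppsOracle g (d s ω)) f xstar L t := by
  refine Finset.measurable_sum _ fun s hs => ?_
  have hs : s < t := Finset.mem_range.1 hs
  have hy := measurable_queryPoint α β hg fun i hi => hd i (hi.trans hs)
  have hz := measurable_proxCentre α β hg fun i hi => hd i (hi.trans hs)
  have he : Measurable fun ω => oracleError α β (fun s => ppsOracle g (d s ω)) f s :=
    (measurable_answer hg (hd s hs) hy).sub (hf.comp hy)
  exact ((he.inner (hz.const_sub xstar)).const_mul _).add ((he.norm.pow_const 2).const_mul _)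

variable {α β}

/-- A random variable that is determined by the draws `0, …, t - 1` is independent of the draw `t`:
the hypothesis on `X` asks for measurability with respect to any σ-algebra that makes these draws
measurable. -/
theorem indepFun_of_measurable_past {μ : Measure Ω} {T : ℕ} (hd : ∀ t ≤ T, Measurable (d t))
    (hind : iIndepFun (fun t : Fin (T + 1) => d t) μ) {t : ℕ} (ht : t ≤ T) {γ : Type*}
    [mγ : MeasurableSpace γ] {X : Ω → γ}
    (hX : ∀ m : MeasurableSpace Ω, (∀ s < t, Measurable[m] (d s)) → Measurable[m] X) :
    IndepFun X (d t) μ := by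
  let m : Fin (T + 1) → MeasurableSpace Ω := fun i => MeasurableSpace.comap (d i) inferInstance
  have hm : ∀ i, m i ≤ ‹MeasurableSpace Ω› := fun i =>
    (hd i (Nat.lt_succ_iff.1 i.2)).comap_le
  have hdisj : Disjoint {i : Fin (T + 1) | i.1 < t}
      {(⟨t, Nat.lt_succ_of_le ht⟩ : Fin (T + 1))} := by
    simp
  have h := indep_iSup_of_disjoint hm hind hdisj
  rw [IndepFun_iff_Indep]
  refine indep_of_indep_of_le_right (indep_of_indep_of_le_left h ?_) ?_
  · refine Measurable.comap_le (hX _ fun s hs => ?_)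
    have hsT : s < T + 1 := by omega
    refine Measurable.mono (comap_measurable (d s)) ?_ le_rfl
    exact le_iSup₂_of_le (f := fun i (_ : i ∈ {i : Fin (T + 1) | i.1 < t}) => m i)
      (⟨s, hsT⟩ : Fin (T + 1)) hs le_rfl
  · exact le_iSup₂_of_le (f := fun i
      (_ : i ∈ ({(⟨t, Nat.lt_succ_of_le ht⟩ : Fin (T + 1))} : Set (Fin (T + 1)))) => m i)
      ⟨t, Nat.lt_succ_of_le ht⟩ rfl le_rfl

end Run

theorem lintegral_comp_prodMk_of_indepFun {Ω γ κ : Type*} [MeasurableSpace Ω] [MeasurableSpace γ]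
    [MeasurableSpace κ] {μ : Measure Ω} [IsProbabilityMeasure μ] {X : Ω → γ} {Y : Ω → κ}
    (hX : Measurable X) (hY : Measurable Y) (h : IndepFun X Y μ) {F : γ × κ → ℝ≥0∞}
    (hF : Measurable F) :
    ∫⁻ ω, F (X ω, Y ω) ∂μ = ∫⁻ ω, ∫⁻ y, F (X ω, y) ∂(μ.map Y) ∂μ := by
  have := Measure.isProbabilityMeasure_map (μ := μ) hX.aemeasurable
  have := Measure.isProbabilityMeasure_map (μ := μ) hY.aemeasurable
  rw [← lintegral_map (f := F) hF (hX.prodMk hY),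
    (indepFun_iff_map_prod_eq_prod_map_map hX.aemeasurable hY.aemeasurable).1 h,
    lintegral_prod _ hF.aemeasurable, lintegral_map hF.lintegral_prod_right' hX]

/-! ### Exponential moments of the accumulated error -/

theorem AdmissibleCoeffs.sq_div_beta_le {L : ℝ≥0} {T : ℕ} {α β : ℕ → ℝ}
    (h : AdmissibleCoeffs L T α β) {t : ℕ} (ht : t ≤ T) :
    α t ^ 2 / β (t - 1) ≤ cumWeight α t / (β t - L) := by
  have hβ := h.beta_pos ht
  have hA := h.cumWeight_pos ht
  have h1 : cumWeight α t / β t ≤ cumWeight α t / (β t - L) :=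
    div_le_div_of_nonneg_left hA.le (sub_pos.2 (h.lt_beta t ht)) (sub_le_self _ L.2)
  refine le_trans ?_ h1
  cases t with
  | zero =>
    have hA0 : cumWeight α 0 = α 0 := by simp [cumWeight]
    rw [hA0]
    have := h.zero_pos
    have := h.zero_le_one
    gcongr
    nlinarith
  | succ t =>
    have hβ' := h.beta_pos (t.le_succ.trans ht)
    rw [Nat.add_sub_cancel, div_le_div_iff₀ hβ' hβ, mul_comm (cumWeight α (t + 1))]
    exact h.step t ht

/-- Exponential moment of the accumulated error. The variance of the martingale part grows with the
distance of the prox-centre from the minimiser, that is, with the accumulated error itself. This is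
compensated by an exponent `lam` that decreases along the run: if `lam` is admissible after step
`t`, then `lam + (4/9) lam² α_t² v_t / β_{t-1}` is admissible before it. -/
theorem lintegral_exp_errorSum_le {n : ℕ} [NeZero n] {f : Vec n → ℝ} {L : ℝ≥0} {xstar : Vec n}
    {R : ℝ} (hc : ConvexOn ℝ Set.univ f) (hdf : Differentiable ℝ f)
    (hL : LipschitzWith L (gradient f)) (hmin : ∀ x, f xstar ≤ f x) (hR : ‖xstar‖ ≤ R)
    {Ξ : Type*} [MeasurableSpace Ξ] {P : Measure Ξ} [IsProbabilityMeasure P]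
    {g : Vec n → Ξ → Vec n} {σ B : ℝ} (hσ : 0 < σ) (hg : IsGradientOracle P f g σ B)
    {T : ℕ} {α β : ℕ → ℝ} (h : AdmissibleCoeffs L T α β) {r M : ℕ → ℕ} (hr : ∀ t ≤ T, 1 ≤ r t)
    (hM : ∀ t ≤ T, 1 ≤ M t) {Ω : Type*} [MeasurableSpace Ω] {μ : Measure Ω}
    [IsProbabilityMeasure μ] {d : (t : ℕ) → Ω → Draw Ξ (r t) (M t)}
    (hd : ∀ t ≤ T, Measurable (d t)) (hlaw : ∀ t ≤ T, μ.map (d t) = drawLaw P (r t) (M t))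
    (hind : iIndepFun (fun t : Fin (T + 1) => d t) μ) {v w : ℕ → ℝ}
    (hv : ∀ t, v t = noiseVar n σ B (r t) (M t))
    (hw : ∀ t, w t = cumWeight α t * v t / (β t - L)) {m : ℝ} (hm : 0 < m)
    (hmw : ∀ t ≤ T, w t ≤ 2 * m) {t : ℕ} (ht : t ≤ T + 1) {lam : ℝ} (hlam : 0 ≤ lam)
    (hlam1 : lam * (m + 4 / 9 * ∑ s ∈ Finset.range t, w s) ≤ 1) :
    ∫⁻ ω, ENNReal.ofReal (Real.exp
        (lam * errorSum α β (fun s => ppsOracle g (d s ω)) f xstar L t)) ∂μ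
      ≤ ENNReal.ofReal (Real.exp (2 / 9 * R ^ 2 * (∑ s ∈ Finset.range t, α s ^ 2 * v s) / m ^ 2
          + (∑ s ∈ Finset.range t, w s) / (2 * m))) := by
  have hvpos : ∀ t ≤ T, 0 < v t := fun t ht => by rw [hv]; exact noiseVar_pos hσ B (hr t ht)
  have hwpos : ∀ t ≤ T, 0 < w t := fun t ht => by
    rw [hw]
    have := h.cumWeight_pos ht
    have := hvpos t ht
    have := sub_pos.2 (h.lt_beta t ht)
    positivity
  induction t generalizing lam with
  | zero => simp [errorSum]
  | succ t ih =>
    have ht' : t ≤ T := Nat.le_of_succ_le_succ ht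
    have hvt := hvpos t ht'
    have hwt := hwpos t ht'
    have hβ' : 0 < β (t - 1) := h.beta_pos ((Nat.sub_le t 1).trans ht')
    have hbL := sub_pos.2 (h.lt_beta t ht')
    have hq : 0 ≤ ∑ s ∈ Finset.range t, w s := Finset.sum_nonneg fun s hs =>
      (hwpos s ((Finset.mem_range.1 hs).le.trans ht')).le
    have ih := @ih (by omega)
    rw [Finset.sum_range_succ] at hlam1
    generalize hQ : ∑ s ∈ Finset.range t, w s = Q at *
    -- the exponent before the step
    obtain ⟨w', hw'⟩ : ∃ w', w' = α t ^ 2 * v t / β (t - 1) := ⟨_, rfl⟩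
    have hw'0 : 0 ≤ w' := by rw [hw']; positivity
    have hw'w : w' ≤ w t := by
      rw [hw', hw, mul_div_right_comm, mul_div_right_comm]
      exact mul_le_mul_of_nonneg_right (h.sq_div_beta_le ht') hvt.le
    have hlamm : lam * m ≤ 1 := by nlinarith [mul_nonneg hlam hq, mul_nonneg hlam hwt.le]
    have hadm : (lam + 4 / 9 * lam ^ 2 * w') * (m + 4 / 9 * Q) ≤ 1 := by
      have hx : 0 ≤ lam * (m + 4 / 9 * Q) := by positivity
      have hz : 4 / 9 * (lam * w') ≤ 4 / 9 * (lam * w t) := by gcongr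
      have hz0 : 0 ≤ lam * w t := by positivity
      nlinarith [mul_le_mul_of_nonneg_left hz hx]
    obtain ⟨θ, hθ⟩ : ∃ θ, θ = lam * w t / 2 := ⟨_, rfl⟩
    have hθ0 : 0 ≤ θ := by rw [hθ]; positivity
    have hθ1 : θ ≤ 1 := by
      rw [hθ]
      have := mul_le_mul_of_nonneg_left (hmw t ht') hlam
      linarith
    -- the past of the step, and its independence of the draw
    let X : Ω → Vec n × Vec n × ℝ := fun ω =>
      (queryPoint α β (fun s => ppsOracle g (d s ω)) t,
        proxCentre α β (fun s => ppsOracle g (d s ω)) t,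
        errorSum α β (fun s => ppsOracle g (d s ω)) f xstar L t)
    have hgrad : Measurable (gradient f) := hL.continuous.measurable
    have hXm : ∀ m : MeasurableSpace Ω, (∀ s < t, Measurable[m] (d s)) → Measurable[m] X :=
      fun m hm => (measurable_queryPoint α β hg.measurable hm).prodMk
        ((measurable_proxCentre α β hg.measurable hm).prodMk
          (measurable_errorSum α β hg.measurable hgrad xstar L hm))
    have hX : Measurable X := hXm _ fun s hs => hd s (hs.le.trans ht')
    have hindep : IndepFun X (d t) μ := indepFun_of_measurable_past hd hind ht' hXm
    let F : (Vec n × Vec n × ℝ) × Draw Ξ (r t) (M t) → ℝ≥0∞ := fun p =>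
      ENNReal.ofReal (Real.exp (lam * p.1.2.2)) * ENNReal.ofReal (Real.exp
        (⟪(lam * α t) • (xstar - p.1.2.1), ppsOracle g p.2 p.1.1 - gradient f p.1.1⟫
          + θ * (‖ppsOracle g p.2 p.1.1 - gradient f p.1.1‖ ^ 2 / noiseVar n σ B (r t) (M t))))
    have hF : Measurable F := by
      have hy : Measurable fun p : (Vec n × Vec n × ℝ) × Draw Ξ (r t) (M t) => p.1.1 := by fun_prop
      have he : Measurable fun p : (Vec n × Vec n × ℝ) × Draw Ξ (r t) (M t) =>
          ppsOracle g p.2 p.1.1 - gradient f p.1.1 :=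
        ((measurable_ppsOracle hg.measurable).comp (hy.prodMk measurable_snd)).sub (hgrad.comp hy)
      have hu : Measurable fun p : (Vec n × Vec n × ℝ) × Draw Ξ (r t) (M t) =>
          (lam * α t) • (xstar - p.1.2.1) := by fun_prop
      have hi := hu.inner he (𝕜 := ℝ)
      fun_prop
    calc ∫⁻ ω, ENNReal.ofReal (Real.exp
          (lam * errorSum α β (fun s => ppsOracle g (d s ω)) f xstar L (t + 1))) ∂μ
        = ∫⁻ ω, F (X ω, d t ω) ∂μ := by
          refine lintegral_congr fun ω => ?_
          simp only [F, X]
          rw [← ENNReal.ofReal_mul (Real.exp_pos _).le, ← Real.exp_add, errorSum,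
            Finset.sum_range_succ, ← errorSum, oracleError, real_inner_smul_left,
            real_inner_comm, hθ, hw, ← hv]
          congr 2
          field_simp
      _ = ∫⁻ ω, ∫⁻ e, F (X ω, e) ∂(drawLaw P (r t) (M t)) ∂μ := by
          rw [lintegral_comp_prodMk_of_indepFun hX (hd t ht') hindep hF, hlaw t ht']
      _ ≤ ∫⁻ ω, ENNReal.ofReal (Real.exp
              (lam * errorSum α β (fun s => ppsOracle g (d s ω)) f xstar L t))
            * ENNReal.ofReal (Real.exp (2 / 9 * v t * ‖(lam * α t) • (xstar
              - proxCentre α β (fun s => ppsOracle g (d s ω)) t)‖ ^ 2 + θ)) ∂μ := by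
          refine lintegral_mono fun ω => ?_
          simp only [F, X]
          rw [lintegral_const_mul' _ _ ENNReal.ofReal_ne_top, hv]
          gcongr
          exact lintegral_exp_oracleError_le hg hσ (hr t ht') (hM t ht') _ _ hθ0 hθ1
      _ ≤ ∫⁻ ω, ENNReal.ofReal (Real.exp ((lam + 4 / 9 * lam ^ 2 * w')
              * errorSum α β (fun s => ppsOracle g (d s ω)) f xstar L t))
            * ENNReal.ofReal (Real.exp (2 / 9 * R ^ 2 * (α t ^ 2 * v t) / m ^ 2
              + w t / (2 * m))) ∂μ := by
          refine lintegral_mono fun ω => ?_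
          dsimp only
          rw [← ENNReal.ofReal_mul (Real.exp_pos _).le, ← ENNReal.ofReal_mul (Real.exp_pos _).le,
            ← Real.exp_add, ← Real.exp_add]
          refine ENNReal.ofReal_le_ofReal (Real.exp_le_exp.2 ?_)
          have hdist :=
            norm_sub_proxCentre_sq_le (fun s => ppsOracle g (d s ω)) h hc hdf hL hmin ht'
          generalize errorSum α β (fun s => ppsOracle g (d s ω)) f xstar L t = S at *
          rw [norm_smul, mul_pow, Real.norm_eq_abs, sq_abs]
          generalize ‖xstar - proxCentre α β (fun s => ppsOracle g (d s ω)) t‖ = D at *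
          have hR2 : ‖xstar‖ ^ 2 ≤ R ^ 2 := by gcongr
          have hcoef : 0 ≤ 2 / 9 * v t * (lam * α t) ^ 2 := by positivity
          have h1 := mul_le_mul_of_nonneg_left (hdist.trans (add_le_add_left hR2 _)) hcoef
          have e1 : 2 / 9 * v t * (lam * α t) ^ 2 * (R ^ 2 + 2 * S / β (t - 1))
              = 2 / 9 * R ^ 2 * (α t ^ 2 * v t) * lam ^ 2 + 4 / 9 * lam ^ 2 * w' * S := by
            rw [hw']
            field_simp
            ring
          have hl1 : lam ≤ 1 / m := (le_div_iff₀ hm).2 hlamm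
          have h2 : 2 / 9 * R ^ 2 * (α t ^ 2 * v t) * lam ^ 2
              ≤ 2 / 9 * R ^ 2 * (α t ^ 2 * v t) * (1 / m) ^ 2 := by gcongr
          have h3 : θ ≤ w t / (2 * m) := by
            rw [hθ]
            calc lam * w t / 2 ≤ 1 / m * w t / 2 := by gcongr
              _ = w t / (2 * m) := by field_simp
          have e2 : 2 / 9 * R ^ 2 * (α t ^ 2 * v t) * (1 / m) ^ 2
              = 2 / 9 * R ^ 2 * (α t ^ 2 * v t) / m ^ 2 := by field_simp
          linarith
      _ ≤ ENNReal.ofReal (Real.exp (2 / 9 * R ^ 2 * (∑ s ∈ Finset.range t, α s ^ 2 * v s) / m ^ 2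
              + Q / (2 * m)))
            * ENNReal.ofReal (Real.exp (2 / 9 * R ^ 2 * (α t ^ 2 * v t) / m ^ 2
              + w t / (2 * m))) := by
          rw [lintegral_mul_const' _ _ ENNReal.ofReal_ne_top]
          gcongr
          exact ih (by positivity) hadm
      _ = _ := by
          rw [← ENNReal.ofReal_mul (Real.exp_pos _).le, ← Real.exp_add, Finset.sum_range_succ,
            Finset.sum_range_succ, hQ]
          congr 2
          ring

/-! ### The bound -/

theorem one_le_log_four_div {δ : ℝ} (hδ : 0 < δ) (hδ1 : δ < 1) : 1 ≤ Real.log (4 / δ) := by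
  rw [Real.le_log_iff_exp_le (by positivity)]
  have h4 : 4 ≤ 4 / δ := (le_div_iff₀ hδ).2 (by linarith)
  linarith [Real.exp_one_lt_d9]

theorem C₁_one (T : ℕ) (δ : ℝ) :
    C₁ (fun _ => 1) T δ = 2 * √2 + (3 + 2 * √2) * √(3 * Real.log (4 / δ)) := by
  have h2 : √2 * √2 = 2 := Real.mul_self_sqrt zero_le_two
  unfold C₁
  linear_combination (1 + √(3 * Real.log (4 / δ))) * h2

theorem five_mul_sqrt_le_C₁ {T : ℕ} {δ : ℝ} (hl : 0 ≤ Real.log (4 / δ)) :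
    5 * √(Real.log (4 / δ)) ≤ C₁ (fun _ => 1) T δ := by
  rw [C₁_one]
  have h2 : 1 ≤ √2 := Real.one_le_sqrt.2 one_le_two
  have h3 : √(Real.log (4 / δ)) ≤ √(3 * Real.log (4 / δ)) := Real.sqrt_le_sqrt (by linarith)
  have := Real.sqrt_nonneg (Real.log (4 / δ))
  nlinarith

/-- The choice of the parameter `m` of the exponential moment bound: `q / 2` fits the quadratic part
of the error, and `2 ρ / √l` the martingale part, where `ρ = R D`. -/
theorem exponent_le {q ρ l : ℝ} (hq : 0 < q) (hρ : 0 ≤ ρ) (hl : 1 ≤ l) {c : ℝ} (hc : 5 * √l ≤ c)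
    {m : ℝ} (hm : m = q / 2 + 2 * ρ / √l) :
    2 / 9 * ρ ^ 2 / m ^ 2 + q / (2 * m) - 1 / (m + 4 / 9 * q) * (c * ρ + (1 + l) * q) ≤ -l := by
  obtain ⟨k, hk⟩ : ∃ k, k = √l := ⟨_, rfl⟩
  have hk1 : 1 ≤ k := by rw [hk]; exact Real.one_le_sqrt.2 hl
  have hkl : l = k ^ 2 := by rw [hk, Real.sq_sqrt (by linarith)]
  rw [← hk] at hm hc
  have hk0 : 0 < k := by linarith
  have hmpos : 0 < m := by rw [hm]; positivity
  have h1 : 2 / 9 * ρ ^ 2 / m ^ 2 ≤ l / 18 := by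
    rw [div_le_iff₀ (by positivity)]
    have : ρ ≤ m * k / 2 := by
      have e : m * k / 2 = q * k / 4 + ρ := by rw [hm]; field_simp; ring
      rw [e]
      have : 0 ≤ q * k / 4 := by positivity
      linarith
    have := pow_le_pow_left₀ hρ this 2
    rw [hkl]
    nlinarith
  have h2 : q / (2 * m) ≤ 1 := by
    rw [div_le_one (by positivity), hm]
    have : 0 ≤ 2 * ρ / k := by positivity
    linarith
  have h3 : l + l / 18 + 1 ≤ 1 / (m + 4 / 9 * q) * (c * ρ + (1 + l) * q) := by
    rw [one_div_mul_eq_div, le_div_iff₀ (by positivity)]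
    have e : (l + l / 18 + 1) * (m + 4 / 9 * q)
        = 17 / 18 * (19 / 18 * l + 1) * q + (19 / 9 * k + 2 / k) * ρ := by
      rw [hm, hkl]; field_simp; ring
    have h4 : 19 / 9 * k + 2 / k ≤ c := by
      have : 2 / k ≤ 2 * k := by rw [div_le_iff₀ hk0]; nlinarith
      linarith
    have h5 : 17 / 18 * (19 / 18 * l + 1) ≤ 1 + l := by linarith
    rw [e, add_comm]
    gcongr
  linarith

theorem log_four_div_le {δ : ℝ} (hδ : 0 < δ) (hδ1 : δ ≤ 1 / 4) :
    1 ≤ Real.log (1 / δ) ∧ Real.log (4 / δ) ≤ 2 * Real.log (1 / δ) := by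
  have h4 : 4 ≤ 1 / δ := by rw [le_div_iff₀ hδ]; linarith
  refine ⟨?_, ?_⟩
  · rw [Real.le_log_iff_exp_le (by positivity)]
    linarith [Real.exp_one_lt_d9]
  · have e : 4 / δ = 4 * (1 / δ) := by ring
    rw [e, Real.log_mul (by norm_num) (by positivity), two_mul]
    gcongr

theorem isBigO_C₂ : C₂ =O[𝓝[>] (0 : ℝ)] fun δ : ℝ => Real.log (1 / δ) := by
  refine IsBigO.of_bound 3 ?_
  filter_upwards [Ioc_mem_nhdsGT (by norm_num : (0 : ℝ) < 1 / 4)] with δ hδ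
  obtain ⟨h1, h2⟩ := log_four_div_le hδ.1 hδ.2
  have h3 := one_le_log_four_div hδ.1 (hδ.2.trans_lt (by norm_num))
  rw [Real.norm_of_nonneg (by unfold C₂; linarith), Real.norm_of_nonneg (by linarith), C₂]
  linarith

theorem isBigO_C₁_one (i : ℕ) :
    (fun p : ℕ × ℝ => C₁ (fun _ => 1) p.1 p.2) =O[atTop ×ˢ 𝓝[>] (0 : ℝ)]
      fun p : ℕ × ℝ => poly i (Real.log p.1) * √(Real.log (1 / p.2)) := by
  refine IsBigO.of_bound (2 * √2 + (3 + 2 * √2) * √6) ?_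
  have hδ : ∀ᶠ p : ℕ × ℝ in atTop ×ˢ 𝓝[>] (0 : ℝ), p.2 ∈ Set.Ioc (0 : ℝ) (1 / 4) :=
    Eventually.prod_inr (Ioc_mem_nhdsGT (by norm_num)) _
  filter_upwards [hδ] with p hδ
  obtain ⟨h1, h2⟩ := log_four_div_le hδ.1 hδ.2
  have hpoly : 1 ≤ poly i (Real.log p.1) := by
    have h0 : 0 ≤ Real.log p.1 := Real.log_natCast_nonneg _
    calc (1 : ℝ) = Real.log p.1 ^ 0 := (pow_zero _).symm
      _ ≤ poly i (Real.log p.1) := Finset.single_le_sum (f := fun j => Real.log p.1 ^ j)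
          (fun j _ => pow_nonneg h0 j) (Finset.mem_range.2 (Nat.succ_pos i))
  rw [C₁_one, Real.norm_of_nonneg (by positivity), Real.norm_of_nonneg (by positivity)]
  have hs : √(3 * Real.log (4 / p.2)) ≤ √6 * √(Real.log (1 / p.2)) := by
    rw [← Real.sqrt_mul (by norm_num)]
    exact Real.sqrt_le_sqrt (by linarith)
  have hs1 : 1 ≤ √(Real.log (1 / p.2)) := Real.one_le_sqrt.2 h1
  generalize √(Real.log (1 / p.2)) = x at *
  calc 2 * √2 + (3 + 2 * √2) * √(3 * Real.log (4 / p.2))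
      ≤ 2 * √2 * x + (3 + 2 * √2) * (√6 * x) := by
        have h3 : 2 * √2 ≤ 2 * √2 * x := le_mul_of_one_le_right (by positivity) hs1
        gcongr
    _ = (2 * √2 + (3 + 2 * √2) * √6) * (1 * x) := by ring
    _ ≤ _ := by gcongr

end PPS

theorem theorem1 :
    ∃ J : ℕ → ℝ,
      (∃ i : ℕ, J =O[atTop] fun T : ℕ => PPS.poly i (Real.log T)) ∧
      (∃ i : ℕ, (fun p : ℕ × ℝ => PPS.C₁ J p.1 p.2) =O[atTop ×ˢ 𝓝[>] (0 : ℝ)]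
        fun p : ℕ × ℝ => PPS.poly i (Real.log p.1) * √(Real.log (1 / p.2))) ∧
      (PPS.C₂ =O[𝓝[>] (0 : ℝ)] fun δ : ℝ => Real.log (1 / δ)) ∧
      ∀ (n : ℕ) [NeZero n]
        -- the problem: `f` is convex with `L`-Lipschitz gradient and minimiser `xstar`
        (f : PPS.Vec n → ℝ) (L : ℝ≥0) (xstar : PPS.Vec n) (R : ℝ)
        (_ : ConvexOn ℝ Set.univ f) (_ : Differentiable ℝ f) (_ : LipschitzWith L (gradient f))
        (_ : ∀ x, f xstar ≤ f x) (_ : ‖xstar‖ ≤ R)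
        -- the stochastic gradient oracle
        (Ξ : Type*) [MeasurableSpace Ξ] (P : Measure Ξ) [IsProbabilityMeasure P]
        (g : PPS.Vec n → Ξ → PPS.Vec n) (σ B : ℝ) (_ : 0 < σ)
        (_ : PPS.IsGradientOracle P f g σ B)
        -- the parameters of the method
        (T : ℕ) (α β : ℕ → ℝ) (_ : PPS.AdmissibleCoeffs L T α β)
        (r M : ℕ → ℕ) (_ : ∀ t ≤ T, 1 ≤ r t) (_ : ∀ t ≤ T, 1 ≤ M t)
        -- the randomness of the oracle calls `0, …, T`
        (Ω : Type*) [MeasurableSpace Ω] (μ : Measure Ω) [IsProbabilityMeasure μ]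
        (d : (t : ℕ) → Ω → PPS.Draw Ξ (r t) (M t))
        (_ : ∀ t ≤ T, Measurable (d t))
        (_ : ∀ t ≤ T, μ.map (d t) = PPS.drawLaw P (r t) (M t))
        (_ : iIndepFun (fun t : Fin (T + 1) => d t) μ)
        (δ : ℝ) (_ : 0 < δ) (_ : δ < 1),
        1 - δ < μ.real {ω | f (PPS.primalOutput g α β r M (fun t => d t ω) T) - f xstar
          ≤ PPS.accuracy J T δ L R α β fun t => PPS.noiseVar n σ B (r t) (M t)} := by
  refine ⟨fun _ => 1, ⟨0, ?_⟩, ⟨0, PPS.isBigO_C₁_one 0⟩, PPS.isBigO_C₂, ?_⟩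
  · simpa [PPS.poly] using isBigO_refl (fun _ : ℕ => (1 : ℝ)) atTop
  intro n _ f L xstar R hc hdf hL hmin hR Ξ _ P _ g σ B hσ hg T α β h r M hr hM Ω _ μ _ d hd hlaw
    hind δ hδ hδ1
  obtain ⟨v, hv⟩ : ∃ v : ℕ → ℝ, v = fun t => PPS.noiseVar n σ B (r t) (M t) := ⟨_, rfl⟩
  obtain ⟨w, hw⟩ : ∃ w : ℕ → ℝ, w = fun t => PPS.cumWeight α t * v t / (β t - L) := ⟨_, rfl⟩
  rw [← hv]
  obtain ⟨q, hq⟩ : ∃ q, q = ∑ t ∈ Finset.range (T + 1), w t := ⟨_, rfl⟩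
  obtain ⟨D, hD⟩ : ∃ D, D = √(∑ t ∈ Finset.range (T + 1), α t ^ 2 * v t) := ⟨_, rfl⟩
  obtain ⟨l, hl⟩ : ∃ l, l = Real.log (4 / δ) := ⟨_, rfl⟩
  have hR0 : 0 ≤ R := (norm_nonneg _).trans hR
  have hvpos : ∀ t ≤ T, 0 < v t := fun t ht => by
    rw [hv]; exact PPS.noiseVar_pos hσ B (hr t ht)
  have hwpos : ∀ t ≤ T, 0 < w t := fun t ht => by
    rw [hw]
    exact div_pos (mul_pos (h.cumWeight_pos ht) (hvpos t ht)) (sub_pos.2 (h.lt_beta t ht))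
  have hwq : ∀ t ≤ T, w t ≤ q := fun t ht => by
    rw [hq]
    exact Finset.single_le_sum
      (fun s hs => (hwpos s (Nat.lt_succ_iff.1 (Finset.mem_range.1 hs))).le)
      (Finset.mem_range.2 (Nat.lt_succ_of_le ht))
  have hq0 : 0 < q := (hwpos 0 T.zero_le).trans_le (hwq 0 T.zero_le)
  have hD0 : 0 ≤ D := by rw [hD]; exact Real.sqrt_nonneg _
  have hDsq : ∑ t ∈ Finset.range (T + 1), α t ^ 2 * v t = D ^ 2 := by
    rw [hD, Real.sq_sqrt]
    exact Finset.sum_nonneg fun s hs => mul_nonneg (sq_nonneg _)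
      (hvpos s (Nat.lt_succ_iff.1 (Finset.mem_range.1 hs))).le
  have hl1 : 1 ≤ l := by rw [hl]; exact PPS.one_le_log_four_div hδ hδ1
  -- the only property of the constant that matters; it is far from sharp
  have hC : 5 * √l ≤ PPS.C₁ (fun _ => 1) T δ := by
    rw [hl] at hl1 ⊢
    exact PPS.five_mul_sqrt_le_C₁ (by linarith)
  obtain ⟨m, hm⟩ : ∃ m, m = q / 2 + 2 * (R * D) / √l := ⟨_, rfl⟩
  have hqm : q / 2 ≤ m := by
    have : 0 ≤ 2 * (R * D) / √l := by positivity
    linarith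
  have hm0 : 0 < m := by linarith
  obtain ⟨lam, hlam⟩ : ∃ lam, lam = 1 / (m + 4 / 9 * q) := ⟨_, rfl⟩
  have hlam0 : 0 < lam := by rw [hlam]; positivity
  obtain ⟨K, hK⟩ : ∃ K, K = PPS.C₁ (fun _ => 1) T δ * (R * D) + (1 + l) * q := ⟨_, rfl⟩
  have hexp := PPS.exponent_le hq0 (mul_nonneg hR0 hD0) hl1 hC hm
  rw [← hlam, ← hK] at hexp
  have hmoment := PPS.lintegral_exp_errorSum_le hc hdf hL hmin hR hσ hg h hr hM hd hlaw hind
    (v := v) (w := w) (fun t => by rw [hv]) (fun t => by rw [hw]) hm0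
    (fun t ht => by linarith [hwq t ht]) le_rfl hlam0.le
    (by rw [← hq, hlam, one_div_mul_cancel (by positivity)])
  rw [← hq, hDsq] at hmoment
  obtain ⟨S, hS⟩ : ∃ S : Ω → ℝ, S = fun ω =>
    PPS.errorSum α β (fun s => PPS.ppsOracle g (d s ω)) f xstar L (T + 1) := ⟨_, rfl⟩
  have hSm : Measurable S := by
    rw [hS]
    exact PPS.measurable_errorSum α β hg.measurable hL.continuous.measurable xstar L
      fun s hs => hd s (Nat.lt_succ_iff.1 hs)
  -- Markov's inequality for `exp (lam S)`
  have hbad : μ {ω | K ≤ S ω} ≤ ENNReal.ofReal (δ / 4) := by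
    have hsub : {ω | K ≤ S ω} ⊆ {ω | ENNReal.ofReal (Real.exp (lam * K))
        ≤ ENNReal.ofReal (Real.exp (lam * S ω))} := fun ω hω =>
      ENNReal.ofReal_le_ofReal (Real.exp_le_exp.2 (mul_le_mul_of_nonneg_left hω hlam0.le))
    have hmarkov := mul_meas_ge_le_lintegral (μ := μ)
      (f := fun ω => ENNReal.ofReal (Real.exp (lam * S ω))) (by fun_prop)
      (ENNReal.ofReal (Real.exp (lam * K)))
    have hKpos : ENNReal.ofReal (Real.exp (lam * K)) ≠ 0 :=
      (ENNReal.ofReal_pos.2 (Real.exp_pos _)).ne'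
    refine (measure_mono hsub).trans ?_
    rw [← ENNReal.mul_le_mul_iff_right hKpos ENNReal.ofReal_ne_top]
    refine hmarkov.trans ?_
    rw [hS]
    refine hmoment.trans ?_
    rw [← ENNReal.ofReal_mul (Real.exp_pos _).le]
    refine ENNReal.ofReal_le_ofReal ?_
    have hδl : δ / 4 = Real.exp (-l) := by
      rw [hl, Real.exp_neg, Real.exp_log (by positivity), inv_div]
    rw [hδl, ← Real.exp_add, Real.exp_le_exp]
    rw [mul_pow, ← mul_assoc] at hexp
    linarith
  have hsub : {ω | K ≤ S ω}ᶜ ⊆ {ω | f (PPS.primalOutput g α β r M (fun t => d t ω) T) - f xstar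
      ≤ PPS.accuracy (fun _ => 1) T δ L R α β v} := by
    intro ω hω
    have hω : S ω < K := not_le.1 hω
    have hgap := PPS.gap_le_errorSum (fun s => PPS.ppsOracle g (d s ω)) h (xstar := xstar) hc hdf hL
      (le_refl T)
    have hA := h.cumWeight_pos (le_refl T)
    have hβ := h.beta_pos (le_refl T)
    have hacc : PPS.accuracy (fun _ => 1) T δ L R α β v
        = (β T / 2 * R ^ 2 + K) / PPS.cumWeight α T := by
      rw [PPS.accuracy, ← hD, hK, PPS.C₂, ← hl, hq, hw]
      field_simp
      ring
    change f (PPS.primalState α β (fun s => PPS.ppsOracle g (d s ω)) T).2 - f xstar ≤ _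
    rw [hacc, le_div_iff₀ hA, mul_comm]
    rw [hS] at hω
    have hR2 : β T / 2 * ‖xstar‖ ^ 2 ≤ β T / 2 * R ^ 2 := by gcongr
    have h0 : 0 ≤ β T / 2
        * ‖xstar - PPS.proxCentre α β (fun s => PPS.ppsOracle g (d s ω)) (T + 1)‖ ^ 2 := by
      positivity
    linarith
  have hmeas : MeasurableSet {ω | K ≤ S ω} := measurableSet_le measurable_const hSm
  calc 1 - δ < 1 - δ / 4 := by linarith
    _ ≤ 1 - μ.real {ω | K ≤ S ω} := by
        have : μ.real {ω | K ≤ S ω} ≤ δ / 4 := ENNReal.toReal_le_of_le_ofReal (by positivity) hbad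
        linarith
    _ = μ.real {ω | K ≤ S ω}ᶜ := (probReal_compl_eq_one_sub hmeas).symm
    _ ≤ _ := measureReal_mono hsub
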